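/- Setting. Let $M$ be a compact smooth two-dimensional manifold, possibly with boundary (the material points), let $T\subseteq\mathbb R$ be an open set of times, let $\boldsymbol X\colon T\times M\to\mathbb R^3$ be smooth with every $\boldsymbol X(t,\cdot)$ an immersion, and let $\psi\colon T\times M\to\mathbb R$ be smooth. $\boldsymbol X(t,\cdot)$ parameterizes the moving surface $\mathcal S=\mathcal S(t)$, $\psi$ is a scalar field on it, $\boldsymbol V=\partial_t\boldsymbol X$ is the material velocity, and $\dot\psi=\partial_t\psi$ (at a fixed material point) is the material time derivative. For $\boldsymbol W\colon\mathcal S\to\mathbb R^3$, $\operatorname{Div}_C\boldsymbol W=\operatorname{tr}\nabla_C\boldsymbol W$ is the trace of the componentwise surface derivative (the derivative of an extension composed with the orthogonal projection onto the tangent plane); $\nabla$ and $\operatorname{div}$ are the surface gradient and the covariant surface divergence, and $\Delta=\operatorname{div}\nabla$. The scalar Truesdell time derivative is $\mathring\psi=\dot\psi+\psi\operatorname{Div}_C\boldsymbol V$. Norms and inner products are those of $L^2(\mathcal S)$. Let $\mathfrak U=\mathfrak U[\boldsymbol X,\psi]$ be a real functional which at every $(\boldsymbol X(t,\cdot),\psi(t,\cdot))$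 is differentiable along smooth one-parameter families, with a derivative that depends linearly on the initial velocity of the family. Let its functional derivatives exist at these points: $D_\psi\mathfrak U$, smooth on $M$ for each $t$, is the $L^2$-gradient with respect to $\psi$ at fixed $\boldsymbol X$, i.e. $\frac{d}{d\varepsilon}\big|_{0}\mathfrak U[\boldsymbol X,\psi+\varepsilon\phi]=\langle D_\psi\mathfrak U,\phi\rangle$ for all smooth $\phi$; and $D_{\boldsymbol X}\mathfrak U$ is the $L^2$-gradient with respect to $\boldsymbol X$ under the Truesdell gauge of surface independence $\eth_{\boldsymbol W}\psi=-\psi\operatorname{Div}_C\boldsymbol W$, i.e. $\frac{d}{d\varepsilon}\big|_{0}\mathfrak U[\boldsymbol X+\varepsilon\boldsymbol W,\psi_\varepsilon]=\langle D_{\boldsymbol X}\mathfrak U,\boldsymbol W\rangle$ for all smooth $\boldsymbol W$ and all smooth families $\psi_\varepsilon$ with $\psi_0=\psi$ and $\frac{d}{d\varepsilon}\big|_{0}\psi_\varepsilon=-\psi\operatorname{Div}_C\boldsymbol W$. Proposition. Let $M_{\boldsymbol X},M_\psi>0$ be constants, and let $(\boldsymbol X,\psi)$ solve the $(L^2,H^{-1})$-surface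 gradient flow $$M_{\boldsymbol X}\boldsymbol V=-D_{\boldsymbol X}\mathfrak U,\qquad M_\psi\mathring\psi=\Delta D_\psi\mathfrak U,$$ or, with the flux $\boldsymbol q$ given by $M_\psi\boldsymbol q=-\nabla D_\psi\mathfrak U$, its form $M_{\boldsymbol X}\boldsymbol V=-D_{\boldsymbol X}\mathfrak U$, $\mathring\psi=-\operatorname{div}\boldsymbol q$. If $\mathcal S$ has a boundary, with outward co-normal $\boldsymbol n$, suppose that the boundary conditions are such that $\int_{\partial\mathcal S}\langle\boldsymbol q,\boldsymbol n\rangle\,dl=0$ and $\int_{\partial\mathcal S}D_\psi\mathfrak U\,\langle\boldsymbol q,\boldsymbol n\rangle\,dl=0$ for all $t\in T$ (for instance $\langle\boldsymbol q,\boldsymbol n\rangle=0$ on $\partial\mathcal S$). Then at every $t\in T$ $$\frac{d}{dt}\int_{\mathcal S}\psi\,d\mathcal S=0,$$ and $$\frac{d}{dt}\mathfrak U=-\Big(M_{\boldsymbol X}^{-1}\|D_{\boldsymbol X}\mathfrak U\|^2+M_\psi^{-1}\|\nabla D_\psi\mathfrak U\|^2\Big)=-\Big(M_{\boldsymbol X}\|\boldsymbol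 V\|^2+M_\psi\|\boldsymbol q\|^2\Big)\le 0 .$$ -/

import Mathlib

open Set Filter Topology
open scoped Manifold ContDiff InnerProductSpace

namespace SurfaceFlow

noncomputable section

/-- The plane, in which coordinates of the surface live. -/
abbrev E2 : Type := EuclideanSpace ℝ (Fin 2)

/-- The ambient Euclidean space. -/
abbrev E3 : Type := EuclideanSpace ℝ (Fin 3)

section Pointwise

/-! Throughout, `M` is the reference manifold of material points (two-dimensional, possibly with
boundary) and `X : M → E3` a parameterization of the surface `S = X(M)`. Fields on `S` are
represented as functions of the material point. -/

variable {M : Type*} [TopologicalSpace M] [ChartedSpace (EuclideanHalfSpace 2) M]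

/-- The differential of an ambient vector field at a point, as a linear map `T_y M → ℝ³`. -/
def vecDiff (W : M → E3) (y : M) : E2 →L[ℝ] E3 :=
  mfderiv (𝓡∂ 2) 𝓘(ℝ, E3) W y

/-- The differential of a scalar field at a point, as a linear form on `T_y M`. -/
def scalDiff (f : M → ℝ) (y : M) : E2 →L[ℝ] ℝ :=
  mfderiv (𝓡∂ 2) 𝓘(ℝ, ℝ) f y

/-- `X` is a smooth immersion, i.e. a regular parameterization of its image. -/
def IsSmoothImmersion (X : M → E3) : Prop :=
  ContMDiff (𝓡∂ 2) 𝓘(ℝ, E3) ∞ X ∧ ∀ y, Function.Injective (vecDiff X y)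

/-- The left inverse `(AᵀA)⁻¹ Aᵀ` of the differential `A = dX_y`: it inverts `A` on the tangent
plane `T_y S = range A` and vanishes on the normal line. -/
def pullToChart (X : M → E3) (y : M) : E3 →L[ℝ] E2 :=
  (ContinuousLinearMap.inverse ((vecDiff X y).adjoint ∘L vecDiff X y)) ∘L (vecDiff X y).adjoint

/-- The orthogonal projection onto the tangent plane of the surface (the surface identity). -/
def tangentProj (X : M → E3) (y : M) : E3 →L[ℝ] E3 :=
  vecDiff X y ∘L pullToChart X y

/-- The surface gradient of a scalar field, as a tangential vector in `ℝ³`. -/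
def surfGrad (X : M → E3) (f : M → ℝ) (y : M) : E3 :=
  (InnerProductSpace.toDual ℝ E3).symm (scalDiff f y ∘L pullToChart X y)

/-- The componentwise surface derivative of an ambient vector field: the derivative of any
extension of the field, composed with the projection onto the tangent plane. -/
def compDeriv (X : M → E3) (W : M → E3) (y : M) : E3 →L[ℝ] E3 :=
  vecDiff W y ∘L pullToChart X y

/-- The componentwise trace-divergence `Div_C W` of an ambient vector field. -/
def compDiv (X : M → E3) (W : M → E3) (y : M) : ℝ :=
  LinearMap.trace ℝ E3 (compDeriv X W y : E3 →ₗ[ℝ] E3)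

/-- The covariant divergence of a tangential vector field: the trace of the tangential part of
its componentwise derivative. -/
def covDiv (X : M → E3) (q : M → E3) (y : M) : ℝ :=
  LinearMap.trace ℝ E3 ((tangentProj X y ∘L compDeriv X q y : E3 →L[ℝ] E3) : E3 →ₗ[ℝ] E3)

/-- The Laplace-Beltrami operator `Δ = div ∘ ∇`. -/
def laplaceBeltrami (X : M → E3) (f : M → ℝ) (y : M) : ℝ :=
  covDiv X (surfGrad X f) y

/-- The outward unit co-normal at a boundary point. Vectors of `T_y M` with positive zeroth
coordinate point inwards, so the co-normal is minus the normalized surface gradient of that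
coordinate. -/
def conormal (X : M → E3) (y : M) : E3 :=
  -(‖(pullToChart X y).adjoint (EuclideanSpace.single 0 1)‖⁻¹ •
    (pullToChart X y).adjoint (EuclideanSpace.single 0 1))

/-- The derivative of the parameterization in the coordinates of the chart centred at `c`. -/
def coordDiff (X : M → E3) (c : M) (z : E2) : E2 →L[ℝ] E3 :=
  fderivWithin ℝ (X ∘ (extChartAt (𝓡∂ 2) c).symm) (range (𝓡∂ 2)) z

/-- The area density `√(det g)` in the coordinates of the chart centred at `c`. -/
def areaDensity (X : M → E3) (c : M) (z : E2) : ℝ :=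
  √((coordDiff X c z).adjoint ∘L coordDiff X c z).det

/-- The line density of the boundary curve `{z₀ = 0}` in the coordinates of the chart centred
at `c`. -/
def lineDensity (X : M → E3) (c : M) (z : E2) : ℝ :=
  ‖coordDiff X c z (EuclideanSpace.single 1 1)‖

end Pointwise

section Integrals

variable {M : Type*} [TopologicalSpace M] [ChartedSpace (EuclideanHalfSpace 2) M]
  [IsManifold (𝓡∂ 2) ∞ M] [CompactSpace M] [T2Space M]

variable (M) in
/-- A smooth partition of unity of `M`, subordinate to the chart domains. It does not depend on
the parameterization. -/
def chartPartition : SmoothPartitionOfUnity M (𝓡∂ 2) M univ :=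
  (SmoothPartitionOfUnity.exists_isSubordinate_chartAt_source (𝓡∂ 2) M).choose

/-- The surface integral `∫_S f dS`, computed in charts with a partition of unity. -/
def surfaceIntegral (X : M → E3) (f : M → ℝ) : ℝ :=
  ∑ᶠ c : M, ∫ z in (extChartAt (𝓡∂ 2) c).target,
    chartPartition M c ((extChartAt (𝓡∂ 2) c).symm z) *
      f ((extChartAt (𝓡∂ 2) c).symm z) * areaDensity X c z

/-- The line integral `∫_{∂S} f dl` over the boundary curve, computed in charts with a partition
of unity. In a chart of `M` the boundary is the part of the line `{z₀ = 0}` in its target. -/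
def boundaryIntegral (X : M → E3) (f : M → ℝ) : ℝ :=
  ∑ᶠ c : M, ∫ s in {s : ℝ | (!₂[0, s] : E2) ∈ (extChartAt (𝓡∂ 2) c).target},
    chartPartition M c ((extChartAt (𝓡∂ 2) c).symm !₂[0, s]) *
      f ((extChartAt (𝓡∂ 2) c).symm !₂[0, s]) * lineDensity X c !₂[0, s]

/-- The `L²` inner product of scalar fields on the surface. -/
def scalInner (X : M → E3) (f g : M → ℝ) : ℝ :=
  surfaceIntegral X fun y => f y * g y

/-- The `L²` inner product of vector fields on the surface. -/
def vecInner (X : M → E3) (V W : M → E3) : ℝ :=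
  surfaceIntegral X fun y => ⟪V y, W y⟫_ℝ

/-- The squared `L²` norm of a vector field on the surface. -/
def vecNormSq (X : M → E3) (V : M → E3) : ℝ :=
  surfaceIntegral X fun y => ‖V y‖ ^ 2

end Integrals

section Motion

variable {M : Type*} [TopologicalSpace M] [ChartedSpace (EuclideanHalfSpace 2) M]

/-- A time-dependent field that is smooth in time and space, for times in `T`. -/
def IsSmoothFamily {F : Type*} [NormedAddCommGroup F] [NormedSpace ℝ F] (T : Set ℝ)
    (f : ℝ → M → F) : Prop :=
  ContMDiffOn (𝓘(ℝ, ℝ).prod (𝓡∂ 2)) 𝓘(ℝ, F) ∞ (fun p : ℝ × M => f p.1 p.2) (T ×ˢ univ)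

/-- The time derivative at a fixed material point. For the parameterization by material points it
is the material velocity `V`, for a scalar field its material time derivative. -/
def timeDeriv {F : Type*} [NormedAddCommGroup F] [NormedSpace ℝ F] (f : ℝ → M → F) (t : ℝ)
    (y : M) : F :=
  deriv (fun s => f s y) t

/-- The scalar Truesdell time derivative: the material time derivative plus `ψ Div_C V`. -/
def truesdellRate (X : ℝ → M → E3) (ψ : ℝ → M → ℝ) (t : ℝ) (y : M) : ℝ :=
  timeDeriv ψ t y + ψ t y * compDiv (X t) (timeDeriv X t) y

/-- The Truesdell gauge of surface independence: the deformation derivative of `ψ` in the direction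
of a virtual displacement `W` is `-ψ Div_C W`. -/
def truesdellGauge (X : M → E3) (ψ : M → ℝ) (W : M → E3) (y : M) : ℝ :=
  -(ψ y * compDiv X W y)

/-- The functional `U` is differentiable at `(X, ψ)` with first variation `L`: along every smooth
one-parameter family through `(X, ψ)`, its derivative is the linear functional `L` of the initial
rates of change of the parameterization and the scalar field. -/
def HasFirstVariation (U : (M → E3) → (M → ℝ) → ℝ) (X : M → E3) (ψ : M → ℝ)
    (L : (M → E3) × (M → ℝ) →ₗ[ℝ] ℝ) : Prop :=
  ∀ (δ : ℝ) (Y : ℝ → M → E3) (χ : ℝ → M → ℝ), 0 < δ →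
    IsSmoothFamily (Ioo (-δ) δ) Y → IsSmoothFamily (Ioo (-δ) δ) χ → Y 0 = X → χ 0 = ψ →
    HasDerivAt (fun ε => U (Y ε) (χ ε)) (L (timeDeriv Y 0, timeDeriv χ 0)) 0

variable [IsManifold (𝓡∂ 2) ∞ M] [CompactSpace M] [T2Space M]

/-- `g` is the functional derivative `D_ψ U`: the `L²` gradient of `U` under variations of the
scalar field at a fixed surface. -/
def IsScalarFunctionalDeriv (U : (M → E3) → (M → ℝ) → ℝ) (X : M → E3) (ψ : M → ℝ)
    (g : M → ℝ) : Prop :=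
  ∀ φ : M → ℝ, ContMDiff (𝓡∂ 2) 𝓘(ℝ, ℝ) ∞ φ →
    HasDerivAt (fun ε : ℝ => U X (fun y => ψ y + ε * φ y)) (scalInner X g φ) 0

/-- `G` is the functional derivative `D_X U` with respect to the gauge of surface independence `ð`:
the `L²` gradient of `U` under virtual displacements `X + ε W` of the surface, where the scalar
field is an arbitrary smooth family `χ ε` which starts at `ψ` and changes, at `ε = 0`, at the rate
`ð X ψ W` prescribed by the gauge. -/
def IsSpatialFunctionalDeriv (ð : (M → E3) → (M → ℝ) → (M → E3) → M → ℝ)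
    (U : (M → E3) → (M → ℝ) → ℝ) (X : M → E3) (ψ : M → ℝ) (G : M → E3) : Prop :=
  ∀ W : M → E3, ContMDiff (𝓡∂ 2) 𝓘(ℝ, E3) ∞ W →
    ∀ (δ : ℝ) (χ : ℝ → M → ℝ), 0 < δ → IsSmoothFamily (Ioo (-δ) δ) χ → χ 0 = ψ →
      timeDeriv χ 0 = ð X ψ W →
      HasDerivAt (fun ε : ℝ => U (fun y => X y + ε • W y) (χ ε)) (vecInner X G W) 0

end Motion

end

end SurfaceFlow

open SurfaceFlow

/-!
The rate of the energy along the motion is the first variation at `(V, ψ̇)`, where `V` is the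
material velocity. Since `ψ̇ = -ψ Div_C V + ψ̊` with the Truesdell rate `ψ̊`, linearity splits it into
the variation of the surface under the Truesdell gauge and the variation of the scalar field at
fixed surface, so that `dU/dt = ⟨D_X U, V⟩ + ⟨D_ψ U, ψ̊⟩` (`hasDerivAt_energy`). The first term is
`-M_X ‖V‖²` by the flow equation. In the second, `ψ̊ = -div q`, and integration by parts
(`surfaceIntegral_mul_compDiv`) turns it into `⟨∇ D_ψ U, q⟩ = -M_ψ ‖q‖²`, up to a boundary term that
vanishes by assumption. The mass is conserved because its rate is `∫ ψ̊` by the transport theorem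
(`hasDerivAt_surfaceIntegral`), which is a vanishing boundary flux by the divergence theorem
(`surfaceIntegral_compDiv`).

Both integral theorems rest on Jacobi's formula for the area density `√g = √det (AᵀA)`,
`A = dX`: its logarithmic derivative is the trace of `Ȧ A⁺`, with the left inverse
`A⁺ = (AᵀA)⁻¹ Aᵀ` (`hasDerivAt_sqrt_gramDet`). Differentiation in time gives `Div_C V`, since time and
space derivatives commute. Differentiation along the coordinates gives, for a tangential field with
components `w`, that `div (√g w)` is `√g` times the surface divergence
(`exists_hasFDerivAt_density_smul`), because the second derivative of `X` is symmetric. Both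
identities are only needed at interior points of the charts, the boundary being a null set.

The divergence theorem follows chart by chart from the one on the half-plane
(`integral_divergence_halfPlane`), applied to `ρ_c W` for a partition of unity `ρ_c`. To add up the
contributions the integrals over the charts have to be compared: the area element does not depend on
the chart (`chartIntegral_change`), hence `∑ ∫ div (ρ_c W)` is the surface integral of
`∑ div (ρ_c W) = div W` (`sum_chartIntegral_eq`). The boundary integrals need no such comparison,
only the fact that the conormal, defined in the chart at the point itself, can be computed in any
chart, for which changes of coordinates have to preserve the boundary and its inward side
(`tangentCoordChange_zero`).
-/

namespace SurfaceFlow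

open MeasureTheory

/-! ### Linear algebra of injective maps from the plane to space -/

/-- The Moore-Penrose left inverse `(AᵀA)⁻¹ Aᵀ` of an injective linear map `A`. -/
noncomputable def leftInv (A : E2 →L[ℝ] E3) : E3 →L[ℝ] E2 :=
  (ContinuousLinearMap.inverse (A.adjoint ∘L A)) ∘L A.adjoint

/-- The Gram determinant of the columns of `A`, written out. -/
noncomputable def gramDet (A : E2 →L[ℝ] E3) : ℝ :=
  ⟪A (EuclideanSpace.single 0 1), A (EuclideanSpace.single 0 1)⟫_ℝ *
    ⟪A (EuclideanSpace.single 1 1), A (EuclideanSpace.single 1 1)⟫_ℝ -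
  ⟪A (EuclideanSpace.single 0 1), A (EuclideanSpace.single 1 1)⟫_ℝ ^ 2

lemma E2_eq_sum (v : E2) :
    v = v 0 • EuclideanSpace.single 0 1 + v 1 • EuclideanSpace.single 1 1 := by
  ext i; fin_cases i <;> simp

lemma adjoint_comp_self_isInvertible {A : E2 →L[ℝ] E3} (hA : Function.Injective A) :
    (A.adjoint ∘L A).IsInvertible := by
  have hinj : Function.Injective ((A.adjoint ∘L A : E2 →L[ℝ] E2) : E2 →ₗ[ℝ] E2) := by
    rw [injective_iff_map_eq_zero]
    intro v hv
    have h : ⟪A v, A v⟫_ℝ = 0 := by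
      have hv' : A.adjoint (A v) = 0 := hv
      rw [← ContinuousLinearMap.adjoint_inner_left, hv', inner_zero_left]
    rw [inner_self_eq_zero] at h
    exact hA (by rw [h, map_zero])
  exact ⟨(LinearEquiv.ofInjectiveEndo _ hinj).toContinuousLinearEquiv, by ext v : 1; rfl⟩

lemma adjoint_comp_leftInv {A : E2 →L[ℝ] E3} (hA : Function.Injective A) (v : E3) :
    A.adjoint (A (leftInv A v)) = A.adjoint v := by
  obtain ⟨e, he⟩ := adjoint_comp_self_isInvertible hA
  have h1 : leftInv A v = e.symm (A.adjoint v) := by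
    simp [leftInv, ← he, ContinuousLinearMap.inverse_equiv]
  have h2 : A.adjoint (A (leftInv A v)) = e (leftInv A v) :=
    (congrArg (fun B : E2 →L[ℝ] E2 => B (leftInv A v)) he).symm
  rw [h2, h1, e.apply_symm_apply]

/-- The normal equations characterize the left inverse. -/
lemma leftInv_eq_of_inner {A : E2 →L[ℝ] E3} (hA : Function.Injective A) {v : E3} {w : E2}
    (h : ∀ u, ⟪A u, A w⟫_ℝ = ⟪A u, v⟫_ℝ) : leftInv A v = w := by
  apply hA
  rw [← sub_eq_zero, ← inner_self_eq_zero (𝕜 := ℝ)]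
  have key : ∀ u, ⟪A u, A (leftInv A v) - A w⟫_ℝ = 0 := fun u => by
    rw [inner_sub_right, h, ← ContinuousLinearMap.adjoint_inner_right,
      adjoint_comp_leftInv hA, ContinuousLinearMap.adjoint_inner_right, sub_self]
  simpa using key (leftInv A v - w)

lemma inner_apply_leftInv {A : E2 →L[ℝ] E3} (hA : Function.Injective A) (u : E2) (v : E3) :
    ⟪A u, A (leftInv A v)⟫_ℝ = ⟪A u, v⟫_ℝ := by
  rw [← ContinuousLinearMap.adjoint_inner_right, adjoint_comp_leftInv hA,
    ContinuousLinearMap.adjoint_inner_right]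

lemma leftInv_apply_self {A : E2 →L[ℝ] E3} (hA : Function.Injective A) (w : E2) :
    leftInv A (A w) = w :=
  leftInv_eq_of_inner hA fun _ => rfl

lemma leftInv_comp_equiv {A : E2 →L[ℝ] E3} (hA : Function.Injective A) (J : E2 ≃L[ℝ] E2) (v : E3) :
    leftInv (A ∘L (J : E2 →L[ℝ] E2)) v = J.symm (leftInv A v) := by
  apply leftInv_eq_of_inner (A := A ∘L (J : E2 →L[ℝ] E2)) (hA.comp J.injective)
  intro u
  simpa using inner_apply_leftInv hA (J u) v

lemma gramDet_pos {A : E2 →L[ℝ] E3} (hA : Function.Injective A) : 0 < gramDet A := by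
  set a := A (EuclideanSpace.single 0 1) with ha
  set b := A (EuclideanSpace.single 1 1) with hb
  have hb0 : b ≠ 0 := fun h => by
    have := hA (h.trans (map_zero A).symm)
    simpa using congrArg (fun v : E2 => v 1) this
  have hbb : 0 < ⟪b, b⟫_ℝ := real_inner_self_pos.2 hb0
  set u : E2 := ⟪b, b⟫_ℝ • EuclideanSpace.single 0 1 - ⟪a, b⟫_ℝ • EuclideanSpace.single 1 1 with hu
  have hu0 : A u ≠ 0 := fun h => by
    have := hA (h.trans (map_zero A).symm)
    have h0 : ⟪b, b⟫_ℝ = 0 := by simpa [hu] using congrArg (fun v : E2 => v 0) this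
    exact hbb.ne' h0
  have hpos : 0 < ⟪A u, A u⟫_ℝ := real_inner_self_pos.2 hu0
  have hAu : A u = ⟪b, b⟫_ℝ • a - ⟪a, b⟫_ℝ • b := by simp [hu, ha, hb]
  have : ⟪A u, A u⟫_ℝ = ⟪b, b⟫_ℝ * gramDet A := by
    rw [hAu, gramDet, ← ha, ← hb]
    simp only [inner_sub_left, inner_sub_right, real_inner_smul_left, real_inner_smul_right,
      real_inner_comm a b]
    ring
  rw [this] at hpos
  exact (pos_iff_pos_of_mul_pos hpos).1 hbb

lemma leftInv_apply {A : E2 →L[ℝ] E3} (hA : Function.Injective A) (v : E3) :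
    leftInv A v =
      ((⟪A (EuclideanSpace.single 1 1), A (EuclideanSpace.single 1 1)⟫_ℝ *
          ⟪A (EuclideanSpace.single 0 1), v⟫_ℝ -
        ⟪A (EuclideanSpace.single 0 1), A (EuclideanSpace.single 1 1)⟫_ℝ *
          ⟪A (EuclideanSpace.single 1 1), v⟫_ℝ) / gramDet A) • EuclideanSpace.single 0 1 +
      ((⟪A (EuclideanSpace.single 0 1), A (EuclideanSpace.single 0 1)⟫_ℝ *
          ⟪A (EuclideanSpace.single 1 1), v⟫_ℝ -
        ⟪A (EuclideanSpace.single 0 1), A (EuclideanSpace.single 1 1)⟫_ℝ *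
          ⟪A (EuclideanSpace.single 0 1), v⟫_ℝ) / gramDet A) • EuclideanSpace.single 1 1 := by
  have hD := (gramDet_pos hA).ne'
  apply leftInv_eq_of_inner hA
  intro u
  rw [E2_eq_sum u]
  simp only [map_add, map_smul, inner_add_left, inner_add_right, real_inner_smul_left,
    real_inner_smul_right]
  rw [real_inner_comm (A (EuclideanSpace.single 0 1)) (A (EuclideanSpace.single 1 1))]
  field_simp
  unfold gramDet
  ring

lemma trace_E2 (B : E2 →L[ℝ] E2) :
    LinearMap.trace ℝ E2 (B : E2 →ₗ[ℝ] E2) =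
      B (EuclideanSpace.single 0 1) 0 + B (EuclideanSpace.single 1 1) 1 := by
  rw [LinearMap.trace_eq_matrix_trace ℝ (EuclideanSpace.basisFun (Fin 2) ℝ).toBasis,
    Matrix.trace_fin_two]
  simp [LinearMap.toMatrix_apply]

lemma det_E2 (B : E2 →L[ℝ] E2) :
    B.det = B (EuclideanSpace.single 0 1) 0 * B (EuclideanSpace.single 1 1) 1 -
      B (EuclideanSpace.single 1 1) 0 * B (EuclideanSpace.single 0 1) 1 := by
  rw [ContinuousLinearMap.det,
    ← LinearMap.det_toMatrix (EuclideanSpace.basisFun (Fin 2) ℝ).toBasis, Matrix.det_fin_two]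
  simp [LinearMap.toMatrix_apply]

lemma det_adjoint_comp_self (A : E2 →L[ℝ] E3) : (A.adjoint ∘L A).det = gramDet A := by
  have h : ∀ (i : Fin 2) (v : E2), (A.adjoint (A v)) i = ⟪A (EuclideanSpace.single i 1), A v⟫_ℝ :=
    fun i v => by
      rw [← ContinuousLinearMap.adjoint_inner_right, EuclideanSpace.inner_single_left]; simp
  rw [det_E2]
  simp only [ContinuousLinearMap.comp_apply, h, gramDet]
  rw [real_inner_comm (A (EuclideanSpace.single 0 1)) (A (EuclideanSpace.single 1 1))]
  ring

lemma gramDet_comp (A : E2 →L[ℝ] E3) (J : E2 →L[ℝ] E2) :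
    gramDet (A ∘L J) = J.det ^ 2 * gramDet A := by
  have h : ∀ i : Fin 2, A (J (EuclideanSpace.single i 1)) =
      J (EuclideanSpace.single i 1) 0 • A (EuclideanSpace.single 0 1) +
      J (EuclideanSpace.single i 1) 1 • A (EuclideanSpace.single 1 1) := fun i => by
    conv_lhs => rw [E2_eq_sum (J (EuclideanSpace.single i 1))]
    simp
  rw [det_E2]
  simp only [gramDet, ContinuousLinearMap.comp_apply, h, inner_add_left, inner_add_right,
    real_inner_smul_left, real_inner_smul_right]
  rw [real_inner_comm (A (EuclideanSpace.single 0 1)) (A (EuclideanSpace.single 1 1))]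
  ring

lemma trace_comp_leftInv (A B : E2 →L[ℝ] E3) :
    LinearMap.trace ℝ E3 ((B ∘L leftInv A : E3 →L[ℝ] E3) : E3 →ₗ[ℝ] E3) =
      leftInv A (B (EuclideanSpace.single 0 1)) 0 +
        leftInv A (B (EuclideanSpace.single 1 1)) 1 := by
  have := LinearMap.trace_comp_comm' (leftInv A : E3 →ₗ[ℝ] E2) (B : E2 →ₗ[ℝ] E3)
  rw [ContinuousLinearMap.toLinearMap_comp, this, ← ContinuousLinearMap.toLinearMap_comp, trace_E2]
  rfl

/-- Half the derivative of the Gram determinant in the direction `B` is the Gram determinant times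
the trace of `B A⁺`: Jacobi's formula. -/
lemma gramDet_mul_trace {A : E2 →L[ℝ] E3} (hA : Function.Injective A) (B : E2 →L[ℝ] E3) :
    gramDet A * LinearMap.trace ℝ E3 ((B ∘L leftInv A : E3 →L[ℝ] E3) : E3 →ₗ[ℝ] E3) =
      ⟪A (EuclideanSpace.single 1 1), A (EuclideanSpace.single 1 1)⟫_ℝ *
        ⟪A (EuclideanSpace.single 0 1), B (EuclideanSpace.single 0 1)⟫_ℝ +
      ⟪A (EuclideanSpace.single 0 1), A (EuclideanSpace.single 0 1)⟫_ℝ *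
        ⟪A (EuclideanSpace.single 1 1), B (EuclideanSpace.single 1 1)⟫_ℝ -
      ⟪A (EuclideanSpace.single 0 1), A (EuclideanSpace.single 1 1)⟫_ℝ *
        (⟪A (EuclideanSpace.single 1 1), B (EuclideanSpace.single 0 1)⟫_ℝ +
          ⟪A (EuclideanSpace.single 0 1), B (EuclideanSpace.single 1 1)⟫_ℝ) := by
  have hD := (gramDet_pos hA).ne'
  rw [trace_comp_leftInv, leftInv_apply hA, leftInv_apply hA]
  simp
  field_simp
  ring

/-- The covector `dz₀` on the surface has norm `‖∂₁X‖ / √(det g)`. -/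
lemma norm_adjoint_leftInv {A : E2 →L[ℝ] E3} (hA : Function.Injective A) :
    ‖(leftInv A).adjoint (EuclideanSpace.single 0 1)‖ * √(gramDet A) =
      ‖A (EuclideanSpace.single 1 1)‖ := by
  have hD := gramDet_pos hA
  set a := A (EuclideanSpace.single 0 1) with ha
  set b := A (EuclideanSpace.single 1 1) with hb
  have hu : (leftInv A).adjoint (EuclideanSpace.single 0 1) =
      (gramDet A)⁻¹ • (⟪b, b⟫_ℝ • a - ⟪a, b⟫_ℝ • b) := by
    refine ext_inner_right ℝ fun v => ?_
    rw [ContinuousLinearMap.adjoint_inner_left, EuclideanSpace.inner_single_left, leftInv_apply hA,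
      real_inner_smul_left, inner_sub_left, real_inner_smul_left, real_inner_smul_left]
    simp [← ha, ← hb]
    field_simp
  have hsq : ‖(leftInv A).adjoint (EuclideanSpace.single 0 1)‖ ^ 2 * gramDet A = ‖b‖ ^ 2 := by
    rw [← real_inner_self_eq_norm_sq, ← real_inner_self_eq_norm_sq, hu]
    simp only [inner_sub_left, inner_sub_right, real_inner_smul_left, real_inner_smul_right]
    rw [real_inner_comm a b]
    field_simp
    unfold gramDet
    rw [← ha, ← hb]
    ring
  have h := congrArg Real.sqrt hsq
  rwa [Real.sqrt_mul (sq_nonneg _), Real.sqrt_sq (norm_nonneg _), Real.sqrt_sq (norm_nonneg _)] at h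

/-! ### Differentials and coordinate changes -/

section Charts

variable {M : Type*} [TopologicalSpace M] [ChartedSpace (EuclideanHalfSpace 2) M]
variable {F : Type*} [NormedAddCommGroup F] [NormedSpace ℝ F]

/-- The derivative of a field on `M` in the coordinates of the chart centred at `c`, for fields with
values in any normed space; `coordDiff` is the case of the parameterization. -/
noncomputable def coordDeriv (f : M → F) (c : M) (z : E2) : E2 →L[ℝ] F :=
  fderivWithin ℝ (f ∘ (extChartAt (𝓡∂ 2) c).symm) (range (𝓡∂ 2)) z

lemma mem_range_halfSpace {z : E2} : z ∈ range (𝓡∂ 2) ↔ 0 ≤ z 0 := by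
  rw [range_modelWithCornersEuclideanHalfSpace]; rfl

lemma convex_range_halfSpace : Convex ℝ (range (𝓡∂ 2)) := (𝓡∂ 2).convex_range

lemma uniqueDiffWithinAt_halfSpace {z : E2} (hz : z ∈ range (𝓡∂ 2)) :
    UniqueDiffWithinAt ℝ (range (𝓡∂ 2)) z := (𝓡∂ 2).uniqueDiffOn z hz

lemma extChartAt_mem_range (c p : M) : extChartAt (𝓡∂ 2) c p ∈ range (𝓡∂ 2) := by
  simp [extChartAt, OpenPartialHomeomorph.extend]

lemma extChartAt_target_subset (c : M) : (extChartAt (𝓡∂ 2) c).target ⊆ range (𝓡∂ 2) :=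
  extChartAt_target_subset_range c

lemma mem_interior_target {c : M} {z : E2} (hz : z ∈ (extChartAt (𝓡∂ 2) c).target) :
    z ∈ interior (extChartAt (𝓡∂ 2) c).target ↔ 0 < z 0 := by
  have hi : ∀ w : E2, w ∈ interior (range (𝓡∂ 2)) ↔ 0 < w 0 := fun w => by
    rw [interior_range_modelWithCornersEuclideanHalfSpace]; rfl
  constructor
  · exact fun h => (hi z).1 (interior_mono (extChartAt_target_subset c) h)
  · intro h
    rw [mem_interior_iff_mem_nhds, ← nhdsWithin_eq_nhds.2 (mem_interior_iff_mem_nhds.1 ((hi z).2 h))]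
    exact extChartAt_target_mem_nhdsWithin_of_mem hz

variable {X : M → E3}

lemma IsSmoothImmersion.mdifferentiable (hX : IsSmoothImmersion X) :
    MDifferentiable (𝓡∂ 2) 𝓘(ℝ, E3) X := hX.1.mdifferentiable (by simp)

lemma areaDensity_eq (c : M) (z : E2) : areaDensity X c z = √(gramDet (coordDeriv X c z)) := by
  rw [areaDensity, ← det_adjoint_comp_self]; rfl

variable [IsManifold (𝓡∂ 2) ∞ M]

lemma differentiableWithinAt_chart {f : M → F} (hf : MDifferentiable (𝓡∂ 2) 𝓘(ℝ, F) f) (c : M)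
    {z : E2} (hz : z ∈ (extChartAt (𝓡∂ 2) c).target) :
    DifferentiableWithinAt ℝ (f ∘ (extChartAt (𝓡∂ 2) c).symm) (range (𝓡∂ 2)) z := by
  have hp : (extChartAt (𝓡∂ 2) c).symm z ∈ (chartAt (EuclideanHalfSpace 2) c).source := by
    rw [← extChartAt_source (𝓡∂ 2)]; exact (extChartAt (𝓡∂ 2) c).map_target hz
  have h := (mdifferentiableAt_iff_source_of_mem_source hp).1
    (hf ((extChartAt (𝓡∂ 2) c).symm z))
  rw [(extChartAt (𝓡∂ 2) c).right_inv hz] at h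
  exact h.differentiableWithinAt

/-- The chain rule for a change of coordinates. -/
lemma coordDeriv_change {f : M → F} (hf : MDifferentiable (𝓡∂ 2) 𝓘(ℝ, F) f) {c d p : M}
    (hc : p ∈ (extChartAt (𝓡∂ 2) c).source) (hd : p ∈ (extChartAt (𝓡∂ 2) d).source) :
    coordDeriv f c (extChartAt (𝓡∂ 2) c p) =
      coordDeriv f d (extChartAt (𝓡∂ 2) d p) ∘L tangentCoordChange (𝓡∂ 2) c d p := by
  have hτ := hasFDerivWithinAt_tangentCoordChange (I := 𝓡∂ 2) (x := c) (y := d) (z := p) ⟨hc, hd⟩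
  have hpt : (extChartAt (𝓡∂ 2) d ∘ (extChartAt (𝓡∂ 2) c).symm) (extChartAt (𝓡∂ 2) c p) =
      extChartAt (𝓡∂ 2) d p := by
    rw [Function.comp_apply, (extChartAt (𝓡∂ 2) c).left_inv hc]
  have hfd := (differentiableWithinAt_chart hf d
    ((extChartAt (𝓡∂ 2) d).map_source hd)).hasFDerivWithinAt
  rw [← hpt] at hfd
  have hcomp := hfd.comp _ hτ (fun w _ => extChartAt_mem_range d _)
  rw [hpt] at hcomp
  refine HasFDerivWithinAt.fderivWithin ?_
    (uniqueDiffWithinAt_halfSpace (extChartAt_mem_range c p))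
  refine hcomp.congr_of_eventuallyEq ?_ (by
    simp only [Function.comp_apply, (extChartAt (𝓡∂ 2) c).left_inv hc,
      (extChartAt (𝓡∂ 2) d).left_inv hd])
  have hnear : ∀ᶠ w in 𝓝[range (𝓡∂ 2)] (extChartAt (𝓡∂ 2) c p),
      (extChartAt (𝓡∂ 2) c).symm w ∈ (extChartAt (𝓡∂ 2) d).source := by
    have hcont := (continuousAt_extChartAt_symm' (I := 𝓡∂ 2) hc).tendsto
    rw [(extChartAt (𝓡∂ 2) c).left_inv hc] at hcont
    exact (hcont.mono_left nhdsWithin_le_nhds) (extChartAt_source_mem_nhds' hd)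
  filter_upwards [hnear] with w hw
  simp only [Function.comp_apply, (extChartAt (𝓡∂ 2) d).left_inv hw]

/-- The change of coordinates between two charts at a common point, as an equivalence. -/
noncomputable def coordChangeEquiv {c d p : M} (hc : p ∈ (extChartAt (𝓡∂ 2) c).source)
    (hd : p ∈ (extChartAt (𝓡∂ 2) d).source) : E2 ≃L[ℝ] E2 :=
  ContinuousLinearEquiv.equivOfInverse (tangentCoordChange (𝓡∂ 2) c d p)
    (tangentCoordChange (𝓡∂ 2) d c p)
    (fun v => by
      rw [tangentCoordChange_comp ⟨⟨hc, hd⟩, hc⟩, tangentCoordChange_self hc])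
    (fun v => by
      rw [tangentCoordChange_comp ⟨⟨hd, hc⟩, hd⟩, tangentCoordChange_self hd])

lemma coe_coordChangeEquiv {c d p : M} (hc : p ∈ (extChartAt (𝓡∂ 2) c).source)
    (hd : p ∈ (extChartAt (𝓡∂ 2) d).source) :
    (coordChangeEquiv hc hd : E2 →L[ℝ] E2) = tangentCoordChange (𝓡∂ 2) c d p := rfl

lemma extChartAt_zero_of_zero {c d p : M} (hc : p ∈ (extChartAt (𝓡∂ 2) c).source)
    (hd : p ∈ (extChartAt (𝓡∂ 2) d).source) (h0 : extChartAt (𝓡∂ 2) c p 0 = 0) :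
    extChartAt (𝓡∂ 2) d p 0 = 0 := by
  have h := (𝓡∂ 2).mem_interior_range_iff_of_mem_atlas (n := ∞) (x := p) (by simp)
    (chart_mem_atlas (EuclideanHalfSpace 2) c) (chart_mem_atlas (EuclideanHalfSpace 2) d)
    (by rwa [← extChartAt_source (𝓡∂ 2)]) (by rwa [← extChartAt_source (𝓡∂ 2)])
  have hc' := mem_interior_target ((extChartAt (𝓡∂ 2) c).map_source hc)
  have hd' := mem_interior_target ((extChartAt (𝓡∂ 2) d).map_source hd)
  have h1 : ¬ 0 < extChartAt (𝓡∂ 2) d p 0 := fun hlt =>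
    (hc'.1 (h.2 (hd'.2 hlt))).ne' h0
  exact le_antisymm (not_lt.1 h1) (mem_range_halfSpace.1 (extChartAt_mem_range d p))

/-- At boundary points the inward covector `dz₀` changes only by a positive factor under a change
of coordinates: the boundary is preserved, and so is its inward side. -/
lemma tangentCoordChange_zero {c d p : M} (hc : p ∈ (extChartAt (𝓡∂ 2) c).source)
    (hd : p ∈ (extChartAt (𝓡∂ 2) d).source) (h0 : extChartAt (𝓡∂ 2) c p 0 = 0) :
    ∃ l : ℝ, 0 < l ∧ ∀ v, tangentCoordChange (𝓡∂ 2) c d p v 0 = l * v 0 := by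
  set z := extChartAt (𝓡∂ 2) c p with hz
  set L : E2 →L[ℝ] ℝ := EuclideanSpace.proj 0 ∘L tangentCoordChange (𝓡∂ 2) c d p
  have hτ := hasFDerivWithinAt_tangentCoordChange (I := 𝓡∂ 2) (x := c) (y := d) (z := p) ⟨hc, hd⟩
  have hτ0 : HasFDerivWithinAt
      (fun w => (extChartAt (𝓡∂ 2) d ((extChartAt (𝓡∂ 2) c).symm w)) 0) L (range (𝓡∂ 2)) z :=
    (EuclideanSpace.proj 0 : E2 →L[ℝ] ℝ).hasFDerivAt.comp_hasFDerivWithinAt _ hτ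
  -- `z` minimizes the zeroth coordinate of the transition map over the half-plane
  have hmin : IsLocalMinOn
      (fun w => (extChartAt (𝓡∂ 2) d ((extChartAt (𝓡∂ 2) c).symm w)) 0) (range (𝓡∂ 2)) z := by
    refine Eventually.of_forall fun w => ?_
    simp only [hz, (extChartAt (𝓡∂ 2) c).left_inv hc, extChartAt_zero_of_zero hc hd h0]
    exact mem_range_halfSpace.1 (extChartAt_mem_range d _)
  have hzr : z ∈ range (𝓡∂ 2) := extChartAt_mem_range c p
  have hcone : ∀ v : E2, 0 ≤ v 0 → 0 ≤ L v := fun v hv => by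
    refine hmin.hasFDerivWithinAt_nonneg hτ0 (mem_posTangentConeAt_of_segment_subset ?_)
    refine convex_range_halfSpace.segment_subset hzr (mem_range_halfSpace.2 ?_)
    simpa [h0] using hv
  -- both tangential directions `± e₁` stay in the half-plane
  have h1 : L (EuclideanSpace.single 1 1) = 0 := by
    refine le_antisymm ?_ (hcone _ (by simp))
    have := hcone (-EuclideanSpace.single 1 1) (by simp)
    rw [map_neg] at this
    linarith
  have hlin : ∀ v, tangentCoordChange (𝓡∂ 2) c d p v 0 = L (EuclideanSpace.single 0 1) * v 0 :=
    fun v => by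
      have : L v = v 0 * L (EuclideanSpace.single 0 1) := by
        conv_lhs => rw [E2_eq_sum v]
        simp [h1]
      rw [mul_comm, ← this]; rfl
  refine ⟨L (EuclideanSpace.single 0 1), lt_of_le_of_ne (hcone _ (by simp)) fun h => ?_, hlin⟩
  obtain ⟨v, hv⟩ := (coordChangeEquiv hc hd).surjective (EuclideanSpace.single 0 1)
  have hv0 := hlin v
  rw [← h, zero_mul] at hv0
  have hv' : tangentCoordChange (𝓡∂ 2) c d p v = EuclideanSpace.single 0 1 := hv
  rw [hv'] at hv0
  simp at hv0

lemma mfderiv_eq_coordDeriv {f : M → F} (hf : MDifferentiable (𝓡∂ 2) 𝓘(ℝ, F) f) {c p : M}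
    (hc : p ∈ (extChartAt (𝓡∂ 2) c).source) :
    (mfderiv (𝓡∂ 2) 𝓘(ℝ, F) f p : E2 →L[ℝ] F) = coordDeriv f c (extChartAt (𝓡∂ 2) c p) ∘L
      (coordChangeEquiv (mem_extChartAt_source (I := 𝓡∂ 2) p) hc : E2 →L[ℝ] E2) := by
  have h1 : (mfderiv (𝓡∂ 2) 𝓘(ℝ, F) f p : E2 →L[ℝ] F) =
      coordDeriv f p (extChartAt (𝓡∂ 2) p p) := by
    rw [(hf p).mfderiv]; rfl
  rw [h1, coe_coordChangeEquiv]
  exact coordDeriv_change hf (mem_extChartAt_source p) hc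

lemma vecDiff_eq {W : M → E3} (hW : MDifferentiable (𝓡∂ 2) 𝓘(ℝ, E3) W) {c p : M}
    (hc : p ∈ (extChartAt (𝓡∂ 2) c).source) :
    vecDiff W p = coordDeriv W c (extChartAt (𝓡∂ 2) c p) ∘L
      (coordChangeEquiv (mem_extChartAt_source (I := 𝓡∂ 2) p) hc : E2 →L[ℝ] E2) :=
  mfderiv_eq_coordDeriv hW hc

lemma IsSmoothImmersion.injective_coordDeriv (hX : IsSmoothImmersion X) {c p : M}
    (hc : p ∈ (extChartAt (𝓡∂ 2) c).source) :
    Function.Injective (coordDeriv X c (extChartAt (𝓡∂ 2) c p)) := by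
  have h := hX.2 p
  rw [vecDiff_eq hX.mdifferentiable hc] at h
  intro u v huv
  obtain ⟨u', rfl⟩ := (coordChangeEquiv (mem_extChartAt_source (I := 𝓡∂ 2) p) hc).surjective u
  obtain ⟨v', rfl⟩ := (coordChangeEquiv (mem_extChartAt_source (I := 𝓡∂ 2) p) hc).surjective v
  exact congrArg _ (h huv)

lemma pullToChart_eq (hX : IsSmoothImmersion X) {c p : M}
    (hc : p ∈ (extChartAt (𝓡∂ 2) c).source) :
    pullToChart X p =
      ((coordChangeEquiv (mem_extChartAt_source (I := 𝓡∂ 2) p) hc).symm : E2 →L[ℝ] E2) ∘L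
        leftInv (coordDeriv X c (extChartAt (𝓡∂ 2) c p)) := by
  ext1 v
  have h1 : pullToChart X p = leftInv (vecDiff X p) := rfl
  rw [h1, vecDiff_eq hX.mdifferentiable hc, leftInv_comp_equiv (hX.injective_coordDeriv hc)]
  rfl

lemma mfderiv_comp_pullToChart (hX : IsSmoothImmersion X) {f : M → F}
    (hf : MDifferentiable (𝓡∂ 2) 𝓘(ℝ, F) f) {c p : M}
    (hc : p ∈ (extChartAt (𝓡∂ 2) c).source) :
    (mfderiv (𝓡∂ 2) 𝓘(ℝ, F) f p : E2 →L[ℝ] F) ∘L pullToChart X p =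
      coordDeriv f c (extChartAt (𝓡∂ 2) c p) ∘L
        leftInv (coordDeriv X c (extChartAt (𝓡∂ 2) c p)) := by
  rw [mfderiv_eq_coordDeriv hf hc, pullToChart_eq hX hc]
  ext1 v
  exact congrArg (coordDeriv f c (extChartAt (𝓡∂ 2) c p))
    ((coordChangeEquiv (mem_extChartAt_source (I := 𝓡∂ 2) p) hc).apply_symm_apply _)

lemma compDeriv_eq (hX : IsSmoothImmersion X) {W : M → E3}
    (hW : MDifferentiable (𝓡∂ 2) 𝓘(ℝ, E3) W) {c p : M}
    (hc : p ∈ (extChartAt (𝓡∂ 2) c).source) :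
    compDeriv X W p = coordDeriv W c (extChartAt (𝓡∂ 2) c p) ∘L
      leftInv (coordDeriv X c (extChartAt (𝓡∂ 2) c p)) :=
  mfderiv_comp_pullToChart hX hW hc

lemma tangentProj_eq (hX : IsSmoothImmersion X) {c p : M}
    (hc : p ∈ (extChartAt (𝓡∂ 2) c).source) :
    tangentProj X p = coordDeriv X c (extChartAt (𝓡∂ 2) c p) ∘L
      leftInv (coordDeriv X c (extChartAt (𝓡∂ 2) c p)) :=
  mfderiv_comp_pullToChart hX hX.mdifferentiable hc

lemma inner_surfGrad_eq (hX : IsSmoothImmersion X) {f : M → ℝ}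
    (hf : MDifferentiable (𝓡∂ 2) 𝓘(ℝ, ℝ) f) {c p : M}
    (hc : p ∈ (extChartAt (𝓡∂ 2) c).source) (v : E3) :
    ⟪surfGrad X f p, v⟫_ℝ = coordDeriv f c (extChartAt (𝓡∂ 2) c p)
      (leftInv (coordDeriv X c (extChartAt (𝓡∂ 2) c p)) v) := by
  rw [surfGrad, InnerProductSpace.toDual_symm_apply]
  exact congrArg (fun B : E3 →L[ℝ] ℝ => B v) (mfderiv_comp_pullToChart hX hf hc)

/-- The covariant divergence of any field, as the trace of an endomorphism of the parameter plane. -/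
lemma covDiv_eq (hX : IsSmoothImmersion X) {W : M → E3}
    (hW : MDifferentiable (𝓡∂ 2) 𝓘(ℝ, E3) W) {c p : M}
    (hc : p ∈ (extChartAt (𝓡∂ 2) c).source) :
    covDiv X W p =
      leftInv (coordDeriv X c (extChartAt (𝓡∂ 2) c p))
        (coordDeriv W c (extChartAt (𝓡∂ 2) c p) (EuclideanSpace.single 0 1)) 0 +
      leftInv (coordDeriv X c (extChartAt (𝓡∂ 2) c p))
        (coordDeriv W c (extChartAt (𝓡∂ 2) c p) (EuclideanSpace.single 1 1)) 1 := by
  have hA := hX.injective_coordDeriv hc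
  rw [covDiv, tangentProj_eq hX hc, compDeriv_eq hX hW hc, ← ContinuousLinearMap.comp_assoc,
    trace_comp_leftInv]
  simp only [ContinuousLinearMap.comp_apply, leftInv_apply_self hA]

/-- Along the boundary the normal flux density is, up to the sign of the outward direction, the
zeroth contravariant component times the area density. -/
lemma inner_conormal_mul_lineDensity (hX : IsSmoothImmersion X) {c p : M}
    (hc : p ∈ (extChartAt (𝓡∂ 2) c).source) (h0 : extChartAt (𝓡∂ 2) c p 0 = 0) (W : E3) :
    ⟪W, conormal X p⟫_ℝ * lineDensity X c (extChartAt (𝓡∂ 2) c p) =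
      -(areaDensity X c (extChartAt (𝓡∂ 2) c p) *
        leftInv (coordDeriv X c (extChartAt (𝓡∂ 2) c p)) W 0) := by
  have hA := hX.injective_coordDeriv hc
  set A := coordDeriv X c (extChartAt (𝓡∂ 2) c p) with hAdef
  obtain ⟨l, hl, hJ⟩ := tangentCoordChange_zero hc (mem_extChartAt_source (I := 𝓡∂ 2) p) h0
  have hpull : (pullToChart X p).adjoint (EuclideanSpace.single 0 1) =
      l • (leftInv A).adjoint (EuclideanSpace.single 0 1) := by
    refine ext_inner_right ℝ fun v => ?_
    rw [ContinuousLinearMap.adjoint_inner_left, real_inner_smul_left,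
      ContinuousLinearMap.adjoint_inner_left, EuclideanSpace.inner_single_left,
      EuclideanSpace.inner_single_left, pullToChart_eq hX hc]
    have h2 := hJ (leftInv A v)
    simp only [map_one, one_mul]
    exact h2
  have hdet := gramDet_pos hA
  have hs : 0 < √(gramDet A) := Real.sqrt_pos.2 hdet
  have hline : lineDensity X c (extChartAt (𝓡∂ 2) c p) = ‖A (EuclideanSpace.single 1 1)‖ := rfl
  have hn := norm_adjoint_leftInv hA
  have hb : A (EuclideanSpace.single 1 1) ≠ 0 := fun h => by
    simpa using congrArg (fun v : E2 => v 1) (hA (h.trans (map_zero A).symm))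
  have hu : 0 < ‖(leftInv A).adjoint (EuclideanSpace.single 0 1)‖ := by
    refine norm_pos_iff.2 fun h => hb ?_
    rw [h, norm_zero, zero_mul] at hn
    exact norm_eq_zero.1 hn.symm
  have hW : ⟪W, (leftInv A).adjoint (EuclideanSpace.single 0 1)⟫_ℝ = leftInv A W 0 := by
    rw [ContinuousLinearMap.adjoint_inner_right, EuclideanSpace.inner_single_right]
    simp
  rw [hline, areaDensity_eq, ← hAdef, ← hn, conormal, hpull, norm_smul, Real.norm_of_nonneg hl.le,
    inner_neg_right, real_inner_smul_right, real_inner_smul_right, hW]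
  field_simp

end Charts

/-! ### Smoothness in coordinates -/

section MatrixCalculus

variable {E : Type*} [NormedAddCommGroup E] [NormedSpace ℝ E] {s : Set E} {n : WithTop ℕ∞}

lemma contDiff_gramDet : ContDiff ℝ n gramDet := by
  unfold gramDet
  have h : ∀ v : E2, ContDiff ℝ n fun A : E2 →L[ℝ] E3 => A v := fun v =>
    (ContinuousLinearMap.apply ℝ E3 v).contDiff
  exact (((h _).inner ℝ (h _)).mul ((h _).inner ℝ (h _))).sub (((h _).inner ℝ (h _)).pow 2)

lemma contDiffOn_sqrt_gramDet {A : E → E2 →L[ℝ] E3} (hA : ContDiffOn ℝ n A s)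
    (hinj : ∀ x ∈ s, Function.Injective (A x)) : ContDiffOn ℝ n (fun x => √(gramDet (A x))) s :=
  (contDiff_gramDet.comp_contDiffOn hA).sqrt fun x hx => (gramDet_pos (hinj x hx)).ne'

lemma contDiffOn_leftInv {A : E → E2 →L[ℝ] E3} {v : E → E3} (hA : ContDiffOn ℝ n A s)
    (hv : ContDiffOn ℝ n v s) (hinj : ∀ x ∈ s, Function.Injective (A x)) :
    ContDiffOn ℝ n (fun x => leftInv (A x) (v x)) s := by
  have h : ∀ u : E2, ContDiffOn ℝ n (fun x => A x u) s := fun u =>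
    hA.clm_apply contDiffOn_const
  have hD : ContDiffOn ℝ n (fun x => gramDet (A x)) s := contDiff_gramDet.comp_contDiffOn hA
  refine ContDiffOn.congr ?_ fun x hx => leftInv_apply (hinj x hx) (v x)
  refine ContDiffOn.add (ContDiffOn.smul (ContDiffOn.div ?_ hD
    fun x hx => (gramDet_pos (hinj x hx)).ne') contDiffOn_const)
    (ContDiffOn.smul (ContDiffOn.div ?_ hD
    fun x hx => (gramDet_pos (hinj x hx)).ne') contDiffOn_const)
  · exact (((h _).inner ℝ (h _)).mul ((h _).inner ℝ hv)).sub
      (((h _).inner ℝ (h _)).mul ((h _).inner ℝ hv))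
  · exact (((h _).inner ℝ (h _)).mul ((h _).inner ℝ hv)).sub
      (((h _).inner ℝ (h _)).mul ((h _).inner ℝ hv))

/-- The logarithmic derivative of the area density is the trace of `Ȧ A⁺`. -/
lemma hasDerivAt_sqrt_gramDet {A : ℝ → E2 →L[ℝ] E3} {B : E2 →L[ℝ] E3} {t : ℝ}
    (hA : HasDerivAt A B t) (hinj : Function.Injective (A t)) :
    HasDerivAt (fun s => √(gramDet (A s)))
      (√(gramDet (A t)) *
        LinearMap.trace ℝ E3 ((B ∘L leftInv (A t) : E3 →L[ℝ] E3) : E3 →ₗ[ℝ] E3)) t := by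
  have h : ∀ u : E2, HasDerivAt (fun s => A s u) (B u) t := fun u => by
    simpa using hA.clm_apply (hasDerivAt_const t u)
  have hD := gramDet_pos hinj
  have hs : 0 < √(gramDet (A t)) := Real.sqrt_pos.2 hD
  have hg : HasDerivAt (fun s => gramDet (A s)) (2 * (gramDet (A t) *
      LinearMap.trace ℝ E3 ((B ∘L leftInv (A t) : E3 →L[ℝ] E3) : E3 →ₗ[ℝ] E3))) t := by
    rw [gramDet_mul_trace hinj]
    have := (((h (EuclideanSpace.single 0 1)).inner ℝ (h (EuclideanSpace.single 0 1))).mul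
      ((h (EuclideanSpace.single 1 1)).inner ℝ (h (EuclideanSpace.single 1 1)))).sub
      (((h (EuclideanSpace.single 0 1)).inner ℝ (h (EuclideanSpace.single 1 1))).pow 2)
    refine this.congr_deriv ?_
    rw [real_inner_comm (A t (EuclideanSpace.single 0 1)) (B (EuclideanSpace.single 0 1)),
      real_inner_comm (A t (EuclideanSpace.single 1 1)) (B (EuclideanSpace.single 1 1)),
      real_inner_comm (A t (EuclideanSpace.single 1 1)) (B (EuclideanSpace.single 0 1))]
    push_cast
    ring
  refine (hg.sqrt hD.ne').congr_deriv ?_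
  have h2 : gramDet (A t) = √(gramDet (A t)) * √(gramDet (A t)) := (Real.mul_self_sqrt hD.le).symm
  rw [div_eq_iff (by positivity)]
  linear_combination (2 * LinearMap.trace ℝ E3
    ((B ∘L leftInv (A t) : E3 →L[ℝ] E3) : E3 →ₗ[ℝ] E3)) * h2

end MatrixCalculus

section Families

variable {M : Type*} [TopologicalSpace M] [ChartedSpace (EuclideanHalfSpace 2) M]
variable {F : Type*} [NormedAddCommGroup F] [NormedSpace ℝ F]
variable {T : Set ℝ} {f : ℝ → M → F} {X : M → E3}

lemma IsSmoothFamily.contMDiff (hf : IsSmoothFamily T f) {t : ℝ} (ht : t ∈ T) :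
    ContMDiff (𝓡∂ 2) 𝓘(ℝ, F) ∞ (f t) := by
  rw [← contMDiffOn_univ]
  refine ContMDiffOn.comp (t := T ×ˢ univ) (g := fun p : ℝ × M => f p.1 p.2)
    (f := fun y => (t, y)) hf ?_ (fun y _ => ⟨ht, mem_univ _⟩)
  exact (contMDiff_const.prodMk contMDiff_id).contMDiffOn

lemma isSmoothFamily_const {g : M → F} (hg : ContMDiff (𝓡∂ 2) 𝓘(ℝ, F) ∞ g) :
    IsSmoothFamily T fun _ => g :=
  (hg.comp contMDiff_snd).contMDiffOn

lemma IsSmoothFamily.mdifferentiable (hf : IsSmoothFamily T f) {t : ℝ} (ht : t ∈ T) :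
    MDifferentiable (𝓡∂ 2) 𝓘(ℝ, F) (f t) := (hf.contMDiff ht).mdifferentiable (by simp)

lemma uniqueDiffOn_prod_target (hT : IsOpen T) (c : M) :
    UniqueDiffOn ℝ (T ×ˢ (extChartAt (𝓡∂ 2) c).target) :=
  hT.uniqueDiffOn.prod (uniqueDiffOn_extChartAt_target c)

variable [IsManifold (𝓡∂ 2) ∞ M]

lemma IsSmoothFamily.contDiffOn (hf : IsSmoothFamily T f) (c : M) :
    ContDiffOn ℝ ∞ (fun p : ℝ × E2 => f p.1 ((extChartAt (𝓡∂ 2) c).symm p.2))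
      (T ×ˢ (extChartAt (𝓡∂ 2) c).target) := by
  rw [← contMDiffOn_iff_contDiffOn]
  refine ContMDiffOn.comp (t := T ×ˢ univ) (g := fun p : ℝ × M => f p.1 p.2)
    (f := fun p : ℝ × E2 => (p.1, (extChartAt (𝓡∂ 2) c).symm p.2)) hf ?_
    (fun p hp => ⟨hp.1, mem_univ _⟩)
  refine ContMDiffOn.prodMk contDiff_fst.contMDiff.contMDiffOn ?_
  exact (contMDiffOn_extChartAt_symm c).comp contDiff_snd.contMDiff.contMDiffOn fun p hp => hp.2

lemma isSmoothFamily_of_contDiffOn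
    (hf : ∀ c : M, ContDiffOn ℝ ∞ (fun p : ℝ × E2 => f p.1 ((extChartAt (𝓡∂ 2) c).symm p.2))
      (T ×ˢ (extChartAt (𝓡∂ 2) c).target)) : IsSmoothFamily T f := by
  rintro ⟨t, c⟩ ⟨ht, -⟩
  have h1 : ContMDiffOn (𝓘(ℝ, ℝ).prod (𝓡∂ 2)) 𝓘(ℝ, F) ∞
      (fun p : ℝ × M => f p.1 ((extChartAt (𝓡∂ 2) c).symm (extChartAt (𝓡∂ 2) c p.2)))
      (T ×ˢ (extChartAt (𝓡∂ 2) c).source) := by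
    refine ContMDiffOn.comp (t := T ×ˢ (extChartAt (𝓡∂ 2) c).target)
      (g := fun p : ℝ × E2 => f p.1 ((extChartAt (𝓡∂ 2) c).symm p.2))
      (f := fun p : ℝ × M => (p.1, extChartAt (𝓡∂ 2) c p.2))
      (contMDiffOn_iff_contDiffOn.2 (hf c)) ?_
      (fun p hp => ⟨hp.1, (extChartAt (𝓡∂ 2) c).map_source hp.2⟩)
    refine ContMDiffOn.prodMk_space contMDiffOn_fst ?_
    refine ContMDiffOn.comp (t := (chartAt (EuclideanHalfSpace 2) c).source)
      contMDiffOn_extChartAt contMDiffOn_snd fun p hp => ?_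
    rw [← extChartAt_source (𝓡∂ 2)]; exact hp.2
  have h2 : ContMDiffOn (𝓘(ℝ, ℝ).prod (𝓡∂ 2)) 𝓘(ℝ, F) ∞
      (fun p : ℝ × M => f p.1 p.2) (T ×ˢ (extChartAt (𝓡∂ 2) c).source) := by
    refine h1.congr fun p hp => ?_
    rw [(extChartAt (𝓡∂ 2) c).left_inv hp.2]
  refine (h2 (t, c) ⟨ht, mem_extChartAt_source c⟩).mono_of_mem_nhdsWithin ?_
  rw [nhdsWithin_prod_eq, nhdsWithin_univ]
  exact prod_mem_prod self_mem_nhdsWithin (extChartAt_source_mem_nhds c)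

lemma contDiffOn_chart {g : M → F} (hg : ContMDiff (𝓡∂ 2) 𝓘(ℝ, F) ∞ g) (c : M) :
    ContDiffOn ℝ ∞ (fun z => g ((extChartAt (𝓡∂ 2) c).symm z)) (extChartAt (𝓡∂ 2) c).target := by
  have h := (isSmoothFamily_const (T := univ) hg).contDiffOn c
  exact h.comp (contDiff_const (c := (0 : ℝ)).prodMk contDiff_id).contDiffOn
    fun _ hz => ⟨mem_univ _, hz⟩

lemma contMDiff_of_contDiffOn {g : M → F}
    (hg : ∀ c : M, ContDiffOn ℝ ∞ (fun z => g ((extChartAt (𝓡∂ 2) c).symm z))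
      (extChartAt (𝓡∂ 2) c).target) : ContMDiff (𝓡∂ 2) 𝓘(ℝ, F) ∞ g := by
  refine (isSmoothFamily_of_contDiffOn (T := univ) (f := fun _ => g) fun c => ?_).contMDiff
    (mem_univ (0 : ℝ))
  exact (hg c).comp contDiff_snd.contDiffOn fun p hp => hp.2

lemma IsSmoothFamily.timeDeriv_eq (hf : IsSmoothFamily T f) (hT : IsOpen T) {c : M} {t : ℝ}
    {z : E2} (ht : t ∈ T) (hz : z ∈ (extChartAt (𝓡∂ 2) c).target) :
    HasDerivAt (fun s => f s ((extChartAt (𝓡∂ 2) c).symm z))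
      (fderivWithin ℝ (fun p : ℝ × E2 => f p.1 ((extChartAt (𝓡∂ 2) c).symm p.2))
        (T ×ˢ (extChartAt (𝓡∂ 2) c).target) (t, z) (1, 0)) t := by
  have h1 := ((hf.contDiffOn c).differentiableOn (by simp) (t, z) ⟨ht, hz⟩).hasFDerivWithinAt
  have h2 : HasDerivWithinAt (fun s : ℝ => (s, z)) ((1, 0) : ℝ × E2) T t :=
    ((hasDerivAt_id t).prodMk (hasDerivAt_const t z)).hasDerivWithinAt
  have hmaps : MapsTo (fun s : ℝ => (s, z)) T (T ×ˢ (extChartAt (𝓡∂ 2) c).target) :=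
    fun s hs => ⟨hs, hz⟩
  exact (h1.comp_hasDerivWithinAt t h2 hmaps).hasDerivAt (hT.mem_nhds ht)

lemma IsSmoothFamily.coordDeriv_eq (hf : IsSmoothFamily T f) {c : M} {t : ℝ}
    {z : E2} (ht : t ∈ T) (hz : z ∈ (extChartAt (𝓡∂ 2) c).target) :
    coordDeriv (f t) c z =
      fderivWithin ℝ (fun p : ℝ × E2 => f p.1 ((extChartAt (𝓡∂ 2) c).symm p.2))
        (T ×ˢ (extChartAt (𝓡∂ 2) c).target) (t, z) ∘L ContinuousLinearMap.inr ℝ ℝ E2 := by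
  have h1 := ((hf.contDiffOn c).differentiableOn (by simp) (t, z) ⟨ht, hz⟩).hasFDerivWithinAt
  have h2 : HasFDerivWithinAt (fun w : E2 => (t, w)) (ContinuousLinearMap.inr ℝ ℝ E2)
      (extChartAt (𝓡∂ 2) c).target z := (hasFDerivAt_prodMk_right t z).hasFDerivWithinAt
  have h3 := h1.comp z h2 (fun w hw => ⟨ht, hw⟩)
  exact (h3.mono_of_mem_nhdsWithin (extChartAt_target_mem_nhdsWithin_of_mem hz)).fderivWithin
    (uniqueDiffWithinAt_halfSpace (extChartAt_target_subset c hz))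

lemma IsSmoothFamily.timeDeriv_family (hf : IsSmoothFamily T f) (hT : IsOpen T) :
    IsSmoothFamily T (timeDeriv f) := by
  refine isSmoothFamily_of_contDiffOn fun c => ?_
  have h := (hf.contDiffOn c).fderivWithin (m := ∞) (uniqueDiffOn_prod_target hT c) (by simp)
  refine (h.clm_apply (contDiffOn_const (c := ((1, 0) : ℝ × E2)))).congr fun p hp => ?_
  exact (hf.timeDeriv_eq hT hp.1 hp.2).deriv

lemma IsSmoothFamily.contDiffOn_coordDeriv (hf : IsSmoothFamily T f) (hT : IsOpen T) (c : M) :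
    ContDiffOn ℝ ∞ (fun p : ℝ × E2 => coordDeriv (f p.1) c p.2)
      (T ×ˢ (extChartAt (𝓡∂ 2) c).target) := by
  have h := (hf.contDiffOn c).fderivWithin (m := ∞) (uniqueDiffOn_prod_target hT c) (by simp)
  exact (h.clm_comp contDiffOn_const).congr fun p hp => hf.coordDeriv_eq hp.1 hp.2

lemma contDiffOn_coordDeriv {g : M → F} (hg : ContMDiff (𝓡∂ 2) 𝓘(ℝ, F) ∞ g) (c : M) :
    ContDiffOn ℝ ∞ (coordDeriv g c) (extChartAt (𝓡∂ 2) c).target :=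
  ((isSmoothFamily_const (T := univ) hg).contDiffOn_coordDeriv isOpen_univ c).comp
    (contDiff_const (c := (0 : ℝ)).prodMk contDiff_id).contDiffOn fun _ hz => ⟨mem_univ _, hz⟩

/-- Time and space derivatives commute at interior points of a chart. -/
lemma IsSmoothFamily.hasDerivAt_coordDeriv (hf : IsSmoothFamily T f) (hT : IsOpen T) {c : M} {t : ℝ}
    {z : E2} (ht : t ∈ T) (hz : z ∈ (extChartAt (𝓡∂ 2) c).target) (hz0 : 0 < z 0) :
    HasDerivAt (fun s => coordDeriv (f s) c z) (coordDeriv (timeDeriv f t) c z) t := by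
  set Ω := (extChartAt (𝓡∂ 2) c).target
  set G : ℝ × E2 → F := fun p => f p.1 ((extChartAt (𝓡∂ 2) c).symm p.2)
  have hzi : Ω ∈ 𝓝 z := mem_interior_iff_mem_nhds.1 ((mem_interior_target hz).2 hz0)
  have hnhds : ∀ s ∈ T, ∀ w ∈ interior Ω, T ×ˢ Ω ∈ 𝓝 (s, w) := fun s hs w hw =>
    prod_mem_nhds (hT.mem_nhds hs) (mem_interior_iff_mem_nhds.1 hw)
  have hzI : z ∈ interior Ω := mem_interior_iff_mem_nhds.2 hzi
  have hsmooth : ContDiffAt ℝ ∞ G (t, z) := (hf.contDiffOn c).contDiffAt (hnhds t ht z hzI)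
  have hsymm : IsSymmSndFDerivAt ℝ G (t, z) := hsmooth.isSymmSndFDerivAt (by
    rw [minSmoothness_of_isRCLikeNormedField]; exact WithTop.coe_le_coe.2 (le_top (a := (2 : ℕ∞))))
  have hD : HasFDerivAt (fderiv ℝ G) (fderiv ℝ (fderiv ℝ G) (t, z)) (t, z) :=
    ((hsmooth.fderiv_right (m := ∞) (by simp)).differentiableAt (by simp)).hasFDerivAt
  have h1 : HasDerivAt (fun s : ℝ => fderiv ℝ G (s, z)) (fderiv ℝ (fderiv ℝ G) (t, z) (1, 0)) t :=
    HasFDerivAt.comp_hasDerivAt (f := fun s : ℝ => (s, z)) t hD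
      ((hasDerivAt_id t).prodMk (hasDerivAt_const t z))
  have h2 : HasFDerivAt (fun w : E2 => fderiv ℝ G (t, w) (1, 0))
      ((ContinuousLinearMap.apply ℝ F ((1, 0) : ℝ × E2)) ∘L
        (fderiv ℝ (fderiv ℝ G) (t, z) ∘L ContinuousLinearMap.inr ℝ ℝ E2)) z :=
    (ContinuousLinearMap.apply ℝ F ((1, 0) : ℝ × E2)).hasFDerivAt.comp z
      (HasFDerivAt.comp (f := fun w : E2 => (t, w)) z hD (hasFDerivAt_prodMk_right t z))
  have hV : coordDeriv (timeDeriv f t) c z =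
      (ContinuousLinearMap.apply ℝ F ((1, 0) : ℝ × E2)) ∘L
        (fderiv ℝ (fderiv ℝ G) (t, z) ∘L ContinuousLinearMap.inr ℝ ℝ E2) := by
    refine HasFDerivWithinAt.fderivWithin (HasFDerivAt.hasFDerivWithinAt ?_)
      (uniqueDiffWithinAt_halfSpace (extChartAt_target_subset c hz))
    refine h2.congr_of_eventuallyEq ?_
    filter_upwards [isOpen_interior.mem_nhds hzI] with w hw
    rw [Function.comp_apply, timeDeriv, (hf.timeDeriv_eq hT ht (interior_subset hw)).deriv,
      fderivWithin_of_mem_nhds (hnhds t ht w hw)]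
  have h3 : HasDerivAt (fun s : ℝ => fderiv ℝ G (s, z) ∘L ContinuousLinearMap.inr ℝ ℝ E2)
      (fderiv ℝ (fderiv ℝ G) (t, z) (1, 0) ∘L ContinuousLinearMap.inr ℝ ℝ E2) t := by
    simpa using h1.clm_comp (hasDerivAt_const t (ContinuousLinearMap.inr ℝ ℝ E2))
  have h4 : coordDeriv (timeDeriv f t) c z =
      fderiv ℝ (fderiv ℝ G) (t, z) (1, 0) ∘L ContinuousLinearMap.inr ℝ ℝ E2 := by
    rw [hV]
    ext1 v
    exact hsymm.eq _ _
  rw [h4]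
  refine h3.congr_of_eventuallyEq ?_
  filter_upwards [hT.mem_nhds ht] with s hs
  rw [hf.coordDeriv_eq hs hz, fderivWithin_of_mem_nhds (hnhds s hs z hzI)]

lemma IsSmoothImmersion.injective_coordDeriv_target (hX : IsSmoothImmersion X) {c : M} {z : E2}
    (hz : z ∈ (extChartAt (𝓡∂ 2) c).target) : Function.Injective (coordDeriv X c z) := by
  have := hX.injective_coordDeriv ((extChartAt (𝓡∂ 2) c).map_target hz)
  rwa [(extChartAt (𝓡∂ 2) c).right_inv hz] at this

lemma contDiffOn_areaDensity (hX : IsSmoothImmersion X) (c : M) :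
    ContDiffOn ℝ ∞ (areaDensity X c) (extChartAt (𝓡∂ 2) c).target :=
  (contDiffOn_sqrt_gramDet (contDiffOn_coordDeriv hX.1 c)
    fun _ hz => hX.injective_coordDeriv_target hz).congr fun z _ => areaDensity_eq c z

lemma contMDiff_compDiv (hX : IsSmoothImmersion X) {W : M → E3}
    (hW : ContMDiff (𝓡∂ 2) 𝓘(ℝ, E3) ∞ W) : ContMDiff (𝓡∂ 2) 𝓘(ℝ, ℝ) ∞ (compDiv X W) := by
  refine contMDiff_of_contDiffOn fun c => ?_
  have hl : ∀ v : E2, ContDiffOn ℝ ∞ (fun z => leftInv (coordDeriv X c z) (coordDeriv W c z v))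
      (extChartAt (𝓡∂ 2) c).target := fun v =>
    contDiffOn_leftInv (contDiffOn_coordDeriv hX.1 c)
      ((contDiffOn_coordDeriv hW c).clm_apply contDiffOn_const)
      fun _ hz => hX.injective_coordDeriv_target hz
  refine ContDiffOn.congr ((contDiffOn_euclidean.1 (hl (EuclideanSpace.single 0 1)) 0).add
    (contDiffOn_euclidean.1 (hl (EuclideanSpace.single 1 1)) 1)) fun z hz => ?_
  rw [compDiv, compDeriv_eq hX (hW.mdifferentiable (by simp))
    ((extChartAt (𝓡∂ 2) c).map_target hz), trace_comp_leftInv,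
    (extChartAt (𝓡∂ 2) c).right_inv hz]

/-- For every ambient field the covariant divergence coincides with the
trace-divergence: the normal part of the derivative does not contribute to the trace. -/
lemma covDiv_eq_compDiv (hX : IsSmoothImmersion X) {W : M → E3}
    (hW : MDifferentiable (𝓡∂ 2) 𝓘(ℝ, E3) W) (p : M) : covDiv X W p = compDiv X W p := by
  rw [covDiv_eq hX hW (mem_extChartAt_source p), compDiv,
    compDeriv_eq hX hW (mem_extChartAt_source p), trace_comp_leftInv]

lemma contMDiff_surfGrad (hX : IsSmoothImmersion X) {g : M → ℝ}
    (hg : ContMDiff (𝓡∂ 2) 𝓘(ℝ, ℝ) ∞ g) : ContMDiff (𝓡∂ 2) 𝓘(ℝ, E3) ∞ (surfGrad X g) := by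
  refine contMDiff_of_contDiffOn fun c => contDiffOn_euclidean.2 fun i => ?_
  refine ((contDiffOn_coordDeriv hg c).clm_apply (contDiffOn_leftInv (contDiffOn_coordDeriv hX.1 c)
    (contDiffOn_const (c := EuclideanSpace.single i (1 : ℝ)))
    fun _ hz => hX.injective_coordDeriv_target hz)).congr fun z hz => ?_
  have h := inner_surfGrad_eq hX (hg.mdifferentiable (by simp))
    ((extChartAt (𝓡∂ 2) c).map_target hz) (EuclideanSpace.single i (1 : ℝ))
  rw [(extChartAt (𝓡∂ 2) c).right_inv hz, EuclideanSpace.inner_single_right] at h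
  simpa using h

end Families

/-! ### The divergence theorem in coordinates -/

/-- The identification of `ℝ × ℝ` with the Euclidean plane. -/
noncomputable def planeEquiv : (ℝ × ℝ) ≃L[ℝ] E2 :=
  (ContinuousLinearEquiv.finTwoArrow ℝ ℝ).symm.trans (EuclideanSpace.equiv (Fin 2) ℝ).symm

lemma planeEquiv_apply (p : ℝ × ℝ) : planeEquiv p = !₂[p.1, p.2] := rfl

lemma measurePreserving_planeEquiv : MeasurePreserving planeEquiv :=
  (EuclideanSpace.volume_preserving_symm_measurableEquiv_toLp (Fin 2)).symm.comp
    (volume_preserving_finTwoArrow ℝ).symm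

lemma measurableEmbedding_planeEquiv : MeasurableEmbedding planeEquiv :=
  planeEquiv.toHomeomorph.measurableEmbedding

lemma ae_coord_zero_ne : ∀ᵐ z : E2, z 0 ≠ 0 := by
  rw [ae_iff, ← measurePreserving_planeEquiv.measure_preimage_emb measurableEmbedding_planeEquiv]
  refine measure_mono_null (t := ({0} : Set ℝ) ×ˢ (univ : Set ℝ)) ?_ ?_
  · intro p hp
    exact ⟨not_not.1 hp, mem_univ _⟩
  · rw [Measure.volume_eq_prod, Measure.prod_prod]
    simp

/-- The divergence theorem on the half-plane, for compactly supported fields that are continuous up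
to the boundary and differentiable inside. -/
lemma integral_divergence_halfPlane {P : E2 → E2} {h : E2 → ℝ} {K : Set E2} (hK : IsCompact K)
    (hPK : ∀ z, z ∉ K → P z = 0) (hP : ContinuousOn P (range (𝓡∂ 2)))
    (hdiv : ∀ z : E2, 0 < z 0 → ∃ P' : E2 →L[ℝ] E2, HasFDerivAt P P' z ∧
      P' (EuclideanSpace.single 0 1) 0 + P' (EuclideanSpace.single 1 1) 1 = h z)
    (hh : IntegrableOn h (range (𝓡∂ 2))) :
    ∫ z in range (𝓡∂ 2), h z = -∫ s : ℝ, P !₂[0, s] 0 := by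
  classical
  choose! P' hP' hh' using hdiv
  obtain ⟨R, hR0, hKR⟩ := hK.isBounded.subset_ball_lt 0 0
  have hcoord : ∀ z ∈ K, ∀ i, |z i| < R := fun z hz i => by
    have h1 : ‖z‖ < R := by simpa using hKR hz
    exact lt_of_le_of_lt (PiLp.norm_apply_le z i) h1
  have hout : ∀ z : E2, ∀ i, R ≤ |z i| → P z = 0 := fun z i hz =>
    hPK z fun hmem => absurd (hcoord z hmem i) (not_lt.2 hz)
  have hR' : ((0, -R) : ℝ × ℝ) ≤ (R, R) := ⟨hR0.le, by simpa using hR0.le⟩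
  -- the box `[0, R] × [-R, R]` contains the support of `P` in the half-plane
  set B : Set (ℝ × ℝ) := Icc (0, -R) (R, R) with hB
  have hmemB : ∀ p : ℝ × ℝ, p ∈ B ↔ (0 ≤ p.1 ∧ p.1 ≤ R) ∧ -R ≤ p.2 ∧ p.2 ≤ R := fun p => by
    rw [hB, mem_Icc, Prod.le_def, Prod.le_def]; simp only; tauto
  have hpre : B ⊆ planeEquiv ⁻¹' range (𝓡∂ 2) := fun p hp =>
    mem_range_halfSpace.2 ((hmemB p).1 hp).1.1
  have hpos : ∀ x ∈ Ioo ((0, -R) : ℝ × ℝ).1 (R, R).1 ×ˢ Ioo ((0, -R) : ℝ × ℝ).2 (R, R).2,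
      0 < planeEquiv x 0 := fun x hx => hx.1.1
  have hcont : ContinuousOn (fun x => P (planeEquiv x)) B :=
    hP.comp planeEquiv.continuous.continuousOn hpre
  have hder : ∀ i : Fin 2, ∀ x ∈ Ioo ((0, -R) : ℝ × ℝ).1 (R, R).1 ×ˢ
      Ioo ((0, -R) : ℝ × ℝ).2 (R, R).2, HasFDerivAt (fun x => P (planeEquiv x) i)
        ((EuclideanSpace.proj i : E2 →L[ℝ] ℝ) ∘L (P' (planeEquiv x) ∘L
          (planeEquiv : ℝ × ℝ →L[ℝ] E2))) x := fun i x hx =>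
    (EuclideanSpace.proj i : E2 →L[ℝ] ℝ).hasFDerivAt.comp x
      ((hP' _ (hpos x hx)).comp x planeEquiv.hasFDerivAt)
  have hae : ∀ᵐ x : ℝ × ℝ, planeEquiv x 0 ≠ 0 :=
    measurePreserving_planeEquiv.quasiMeasurePreserving.ae ae_coord_zero_ne
  have he0 : planeEquiv (1, 0) = EuclideanSpace.single 0 1 := by
    ext i; fin_cases i <;> simp [planeEquiv_apply]
  have he1 : planeEquiv (0, 1) = EuclideanSpace.single 1 1 := by
    ext i; fin_cases i <;> simp [planeEquiv_apply]
  have hdivB : ∀ᵐ x : ℝ × ℝ, x ∈ B →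
      h (planeEquiv x) = ((EuclideanSpace.proj 0 : E2 →L[ℝ] ℝ) ∘L (P' (planeEquiv x) ∘L
          (planeEquiv : ℝ × ℝ →L[ℝ] E2))) (1, 0) +
        ((EuclideanSpace.proj 1 : E2 →L[ℝ] ℝ) ∘L (P' (planeEquiv x) ∘L
          (planeEquiv : ℝ × ℝ →L[ℝ] E2))) (0, 1) := by
    filter_upwards [hae] with x hx hxB
    have hx0 : 0 < planeEquiv x 0 := lt_of_le_of_ne ((hmemB x).1 hxB).1.1 (Ne.symm hx)
    rw [← hh' _ hx0, ← he0, ← he1]; rfl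
  have hintB : IntegrableOn (fun x => h (planeEquiv x)) B :=
    ((measurePreserving_planeEquiv.integrableOn_comp_preimage
      measurableEmbedding_planeEquiv).2 hh).mono_set hpre
  have hBm : MeasurableSet B := measurableSet_Icc
  have hbox := integral_divergence_prod_Icc_of_hasFDerivAt_of_le
    (fun x => P (planeEquiv x) 0) (fun x => P (planeEquiv x) 1) _ _ (0, -R) (R, R) hR'
    ((EuclideanSpace.proj 0 : E2 →L[ℝ] ℝ).continuous.comp_continuousOn hcont)
    ((EuclideanSpace.proj 1 : E2 →L[ℝ] ℝ).continuous.comp_continuousOn hcont)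
    (hder 0) (hder 1)
    (hintB.congr_fun_ae ((ae_restrict_iff' hBm).2 hdivB))
  have hz1 : ∀ x : ℝ, P (planeEquiv (x, R)) = 0 := fun x =>
    hout _ 1 (le_abs_self R)
  have hz2 : ∀ x : ℝ, P (planeEquiv (x, -R)) = 0 := fun x =>
    hout _ 1 (by simp [planeEquiv_apply, le_abs_self])
  have hz3 : ∀ y : ℝ, P (planeEquiv (R, y)) = 0 := fun x =>
    hout _ 0 (le_abs_self R)
  simp only [hz1, hz2, hz3, PiLp.zero_apply, intervalIntegral.integral_zero, sub_zero, zero_sub,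
    zero_add] at hbox
  have hL : ∫ z in range (𝓡∂ 2), h z = ∫ x in B, h (planeEquiv x) := by
    rw [← measurePreserving_planeEquiv.setIntegral_preimage_emb measurableEmbedding_planeEquiv]
    refine setIntegral_eq_of_subset_of_ae_sdiff_eq_zero
      (((𝓡∂ 2).isClosed_range.measurableSet).preimage
        planeEquiv.continuous.measurable).nullMeasurableSet hpre ?_
    filter_upwards [hae] with x hx hxB
    have hx0 : 0 < planeEquiv x 0 :=
      lt_of_le_of_ne (mem_range_halfSpace.1 hxB.1) (Ne.symm hx)
    have hxK : planeEquiv x ∉ K := fun hmem => hxB.2 <| (hmemB x).2 <| by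
      have h0 := abs_lt.1 (hcoord _ hmem 0)
      have h1 := abs_lt.1 (hcoord _ hmem 1)
      exact ⟨⟨hx0.le, h0.2.le⟩, h1.1.le, h1.2.le⟩
    -- outside the support the derivative vanishes as well, the support being closed
    have hloc : P =ᶠ[𝓝 (planeEquiv x)] fun _ => 0 := by
      filter_upwards [hK.isClosed.isOpen_compl.mem_nhds hxK] with w hw using hPK w hw
    have h0 : P' (planeEquiv x) = 0 :=
      (hP' _ hx0).unique ((hasFDerivAt_const 0 _).congr_of_eventuallyEq hloc)
    rw [← hh' _ hx0, h0]; simp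
  rw [hL, setIntegral_congr_ae hBm hdivB, hbox, intervalIntegral.integral_of_le (by linarith),
    neg_inj]
  refine setIntegral_eq_integral_of_forall_compl_eq_zero (f := fun s : ℝ => P !₂[0, s] 0)
    fun s hs => ?_
  have hs' : R ≤ |s| := by
    by_contra! hlt
    exact hs ⟨(abs_lt.1 hlt).1, (abs_lt.1 hlt).2.le⟩
  rw [hout !₂[0, s] 1 hs', PiLp.zero_apply]

/-- In coordinates, with `w` the components of a tangential field `W` and `√g` the area density, the
divergence of `r √g w` is `√g (r div W + dr(w))`. The derivative of `√g` is given by Jacobi's formula,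
and the symmetry of the second derivative of the parameterization matches it with the trace of
`dW`. -/
lemma exists_hasFDerivAt_density_smul {Y W : E2 → E3} {r : E2 → ℝ} {U : Set E2} (hU : IsOpen U)
    (hY : ContDiffOn ℝ ∞ Y U) (hinj : ∀ x ∈ U, Function.Injective (fderiv ℝ Y x))
    (hW : ContDiffOn ℝ ∞ W U) (hr : ContDiffOn ℝ ∞ r U)
    (htan : ∀ x ∈ U, fderiv ℝ Y x (leftInv (fderiv ℝ Y x) (W x)) = W x) {z : E2} (hz : z ∈ U) :
    ∃ P' : E2 →L[ℝ] E2,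
      HasFDerivAt (fun x => (r x * √(gramDet (fderiv ℝ Y x))) • leftInv (fderiv ℝ Y x) (W x)) P' z ∧
      P' (EuclideanSpace.single 0 1) 0 + P' (EuclideanSpace.single 1 1) 1 =
        (r z * LinearMap.trace ℝ E3
            ((fderiv ℝ W z ∘L leftInv (fderiv ℝ Y z) : E3 →L[ℝ] E3) : E3 →ₗ[ℝ] E3) +
          fderiv ℝ r z (leftInv (fderiv ℝ Y z) (W z))) * √(gramDet (fderiv ℝ Y z)) := by
  have hUz := hU.mem_nhds hz
  have hA : ContDiffOn ℝ ∞ (fderiv ℝ Y) U := hY.fderiv_of_isOpen hU (by simp)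
  set A := fderiv ℝ Y
  set g : E2 → ℝ := fun x => √(gramDet (A x))
  set w : E2 → E2 := fun x => leftInv (A x) (W x)
  have hdiff : ∀ {G : Type} [NormedAddCommGroup G] [NormedSpace ℝ G] {f : E2 → G},
      ContDiffOn ℝ ∞ f U → HasFDerivAt f (fderiv ℝ f z) z := fun hf =>
    ((hf.contDiffAt hUz).differentiableAt (by simp)).hasFDerivAt
  have hA' := hdiff hA
  have hg' : HasFDerivAt g (fderiv ℝ g z) z := hdiff (contDiffOn_sqrt_gramDet hA hinj)
  have hw' : HasFDerivAt w (fderiv ℝ w z) z := hdiff (contDiffOn_leftInv hA hW hinj)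
  have hW' := hdiff hW
  have hr' := hdiff hr
  have hsymm : ∀ u v, fderiv ℝ A z u v = fderiv ℝ A z v u := fun u v =>
    ((hY.contDiffAt hUz).isSymmSndFDerivAt (by
      rw [minSmoothness_of_isRCLikeNormedField]
      exact WithTop.coe_le_coe.2 (le_top (a := (2 : ℕ∞))))).eq u v
  have hgu : ∀ u, fderiv ℝ g z u = g z * LinearMap.trace ℝ E3
      ((fderiv ℝ A z u ∘L leftInv (A z) : E3 →L[ℝ] E3) : E3 →ₗ[ℝ] E3) := fun u => by
    have hl : HasDerivAt (fun s : ℝ => z + s • u) u 0 := by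
      simpa using ((hasDerivAt_id (0 : ℝ)).smul_const u).const_add z
    have hl0 : z + (0 : ℝ) • u = z := by simp
    have h1 : HasDerivAt (fun s : ℝ => A (z + s • u)) (fderiv ℝ A z u) 0 :=
      HasFDerivAt.comp_hasDerivAt (f := fun s : ℝ => z + s • u) 0 (by rwa [hl0]) hl
    have h2 : HasDerivAt (fun s : ℝ => g (z + s • u)) (fderiv ℝ g z u) 0 :=
      HasFDerivAt.comp_hasDerivAt (l := g) (f := fun s : ℝ => z + s • u) 0 (by rwa [hl0]) hl
    have h3 := hasDerivAt_sqrt_gramDet h1 (by rw [hl0]; exact hinj z hz)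
    rw [hl0] at h3
    exact h2.unique h3
  have hWu : ∀ u, fderiv ℝ W z u = fderiv ℝ A z u (w z) + A z (fderiv ℝ w z u) := fun u => by
    have h1 : HasFDerivAt (fun x => A x (w x))
        (A z ∘L fderiv ℝ w z + (fderiv ℝ A z).flip (w z)) z := hA'.clm_apply hw'
    have h2 := h1.congr_of_eventuallyEq (f₁ := W) (by
      filter_upwards [hUz] with x hx using (htan x hx).symm)
    rw [hW'.unique h2]
    exact add_comm _ _
  have hP : HasFDerivAt (fun x => (r x * g x) • w x) ((r z * g z) • fderiv ℝ w z +
      (r z • fderiv ℝ g z + g z • fderiv ℝ r z).smulRight (w z)) z := (hr'.mul hg').smul hw'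
  refine ⟨_, hP, ?_⟩
  -- `A⁺ dW = A⁺ (dA) w + dw`, and `(d_u A) w = (d_w A) u` by symmetry
  have htr : LinearMap.trace ℝ E3
        ((fderiv ℝ W z ∘L leftInv (A z) : E3 →L[ℝ] E3) : E3 →ₗ[ℝ] E3) =
      LinearMap.trace ℝ E3 ((fderiv ℝ A z (w z) ∘L leftInv (A z) : E3 →L[ℝ] E3) : E3 →ₗ[ℝ] E3) +
        (fderiv ℝ w z (EuclideanSpace.single 0 1) 0 +
          fderiv ℝ w z (EuclideanSpace.single 1 1) 1) := by
    rw [trace_comp_leftInv, trace_comp_leftInv, hWu, hWu, hsymm _ (w z), hsymm _ (w z), map_add,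
      map_add, leftInv_apply_self (hinj z hz), leftInv_apply_self (hinj z hz)]
    simp only [PiLp.add_apply]
    ring
  have htw : LinearMap.trace ℝ E3
        ((fderiv ℝ A z (w z) ∘L leftInv (A z) : E3 →L[ℝ] E3) : E3 →ₗ[ℝ] E3) =
      w z 0 * LinearMap.trace ℝ E3 ((fderiv ℝ A z (EuclideanSpace.single 0 1) ∘L
        leftInv (A z) : E3 →L[ℝ] E3) : E3 →ₗ[ℝ] E3) +
      w z 1 * LinearMap.trace ℝ E3 ((fderiv ℝ A z (EuclideanSpace.single 1 1) ∘L
        leftInv (A z) : E3 →L[ℝ] E3) : E3 →ₗ[ℝ] E3) := by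
    have hlin : fderiv ℝ A z (w z) = w z 0 • fderiv ℝ A z (EuclideanSpace.single 0 1) +
        w z 1 • fderiv ℝ A z (EuclideanSpace.single 1 1) := by
      conv_lhs => rw [E2_eq_sum (w z)]
      rw [map_add, map_smul, map_smul]
    rw [trace_comp_leftInv, trace_comp_leftInv, trace_comp_leftInv, hlin]
    simp only [add_apply, smul_apply, map_add, map_smul, PiLp.add_apply, PiLp.smul_apply,
      smul_eq_mul]
    ring
  have hrw : fderiv ℝ r z (w z) = w z 0 * fderiv ℝ r z (EuclideanSpace.single 0 1) +
      w z 1 * fderiv ℝ r z (EuclideanSpace.single 1 1) := by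
    conv_lhs => rw [E2_eq_sum (w z)]
    rw [map_add, map_smul, map_smul, smul_eq_mul, smul_eq_mul]
  change _ = (r z * _ + fderiv ℝ r z (w z)) * g z
  rw [htr, htw, hrw]
  simp only [add_apply, smul_apply,
    ContinuousLinearMap.smulRight_apply, PiLp.add_apply, PiLp.smul_apply, smul_eq_mul, hgu]
  ring

/-! ### Integrals in charts -/

section ChartIntegral

variable {M : Type*} [TopologicalSpace M] [ChartedSpace (EuclideanHalfSpace 2) M]
variable {X : M → E3}

/-- The integral of a field over the part of the surface covered by the chart centred at `c`. -/
noncomputable def chartIntegral (X : M → E3) (c : M) (f : M → ℝ) : ℝ :=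
  ∫ z in (extChartAt (𝓡∂ 2) c).target, f ((extChartAt (𝓡∂ 2) c).symm z) * areaDensity X c z

lemma measurableSet_coordChange_source (c d : M) :
    MeasurableSet ((extChartAt (𝓡∂ 2) c).target ∩
      (extChartAt (𝓡∂ 2) c).symm ⁻¹' (extChartAt (𝓡∂ 2) d).source) := by
  have h : (extChartAt (𝓡∂ 2) c).target ∩
      (extChartAt (𝓡∂ 2) c).symm ⁻¹' (extChartAt (𝓡∂ 2) d).source =
      (𝓡∂ 2).symm ⁻¹' ((chartAt (EuclideanHalfSpace 2) c).target ∩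
        (chartAt (EuclideanHalfSpace 2) c).symm ⁻¹' (chartAt (EuclideanHalfSpace 2) d).source) ∩
      range (𝓡∂ 2) := by
    rw [extChartAt_target, extChartAt_source]
    ext z
    simp only [mem_inter_iff, mem_preimage, extChartAt_coe_symm, Function.comp_apply]
    tauto
  rw [h]
  exact (((chartAt (EuclideanHalfSpace 2) c).isOpen_inter_preimage_symm
    (chartAt (EuclideanHalfSpace 2) d).open_source).preimage
      (𝓡∂ 2).continuous_symm).measurableSet.inter (𝓡∂ 2).isClosed_range.measurableSet

lemma measurableSet_target (c : M) : MeasurableSet (extChartAt (𝓡∂ 2) c).target := by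
  have h := measurableSet_coordChange_source c c
  rwa [inter_eq_left.2 (show (extChartAt (𝓡∂ 2) c).target ⊆ (extChartAt (𝓡∂ 2) c).symm ⁻¹'
    (extChartAt (𝓡∂ 2) c).source from fun z hz => (extChartAt (𝓡∂ 2) c).map_target hz)] at h

/-- Functions on a chart domain that are continuous and vanish off a compact set are integrable. -/
lemma integrableOn_target {c : M} {h : E2 → ℝ} {K : Set E2} (hK : IsCompact K)
    (hKt : K ⊆ (extChartAt (𝓡∂ 2) c).target)
    (hh : ContinuousOn h (extChartAt (𝓡∂ 2) c).target)
    (h0 : ∀ z ∈ (extChartAt (𝓡∂ 2) c).target, z ∉ K → h z = 0) :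
    IntegrableOn h (extChartAt (𝓡∂ 2) c).target :=
  ((hh.mono hKt).integrableOn_compact hK).of_forall_sdiff_eq_zero (measurableSet_target c)
    fun z hz => h0 z hz.1 hz.2

variable [IsManifold (𝓡∂ 2) ∞ M]

lemma areaDensity_change (hX : MDifferentiable (𝓡∂ 2) 𝓘(ℝ, E3) X) {c d p : M}
    (hc : p ∈ (extChartAt (𝓡∂ 2) c).source) (hd : p ∈ (extChartAt (𝓡∂ 2) d).source) :
    areaDensity X c (extChartAt (𝓡∂ 2) c p) =
      |(tangentCoordChange (𝓡∂ 2) c d p).det| * areaDensity X d (extChartAt (𝓡∂ 2) d p) := by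
  rw [areaDensity_eq, areaDensity_eq, coordDeriv_change hX hc hd, gramDet_comp,
    Real.sqrt_mul (sq_nonneg _), Real.sqrt_sq_eq_abs]

/-- The area element does not depend on the chart. -/
lemma chartIntegral_change (hX : MDifferentiable (𝓡∂ 2) 𝓘(ℝ, E3) X) {c d : M} {f : M → ℝ}
    (hfc : ∀ p, f p ≠ 0 → p ∈ (extChartAt (𝓡∂ 2) c).source)
    (hfd : ∀ p, f p ≠ 0 → p ∈ (extChartAt (𝓡∂ 2) d).source) :
    chartIntegral X c f = chartIntegral X d f := by
  set S : M → M → Set E2 := fun a b => (extChartAt (𝓡∂ 2) a).target ∩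
      (extChartAt (𝓡∂ 2) a).symm ⁻¹' (extChartAt (𝓡∂ 2) b).source
  have hres : ∀ a b, (∀ p, f p ≠ 0 → p ∈ (extChartAt (𝓡∂ 2) b).source) →
      chartIntegral X a f =
        ∫ z in S a b, f ((extChartAt (𝓡∂ 2) a).symm z) * areaDensity X a z := by
    intro a b hb
    refine setIntegral_eq_of_subset_of_forall_sdiff_eq_zero (measurableSet_target a)
      inter_subset_left fun z hz => ?_
    have : f ((extChartAt (𝓡∂ 2) a).symm z) = 0 := by
      by_contra h
      exact hz.2 ⟨hz.1, hb _ h⟩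
    rw [this, zero_mul]
  set τ : E2 → E2 := extChartAt (𝓡∂ 2) d ∘ (extChartAt (𝓡∂ 2) c).symm with hτ
  have himage : τ '' S c d = S d c := by
    ext w
    constructor
    · rintro ⟨z, hz, rfl⟩
      refine ⟨(extChartAt (𝓡∂ 2) d).map_source hz.2, ?_⟩
      rw [mem_preimage, hτ, Function.comp_apply, (extChartAt (𝓡∂ 2) d).left_inv hz.2]
      exact (extChartAt (𝓡∂ 2) c).map_target hz.1
    · intro hw
      refine ⟨extChartAt (𝓡∂ 2) c ((extChartAt (𝓡∂ 2) d).symm w),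
        ⟨(extChartAt (𝓡∂ 2) c).map_source hw.2, ?_⟩, ?_⟩
      · rw [mem_preimage, (extChartAt (𝓡∂ 2) c).left_inv hw.2]
        exact (extChartAt (𝓡∂ 2) d).map_target hw.1
      · rw [hτ, Function.comp_apply, (extChartAt (𝓡∂ 2) c).left_inv hw.2,
          (extChartAt (𝓡∂ 2) d).right_inv hw.1]
  have hinj : InjOn τ (S c d) := fun z hz z' hz' h => by
    have h1 := (extChartAt (𝓡∂ 2) d).injOn hz.2 hz'.2 h
    exact (extChartAt (𝓡∂ 2) c).symm.injOn hz.1 hz'.1 h1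
  have hder : ∀ z ∈ S c d, HasFDerivWithinAt τ
      (tangentCoordChange (𝓡∂ 2) c d ((extChartAt (𝓡∂ 2) c).symm z)) (S c d) z := fun z hz => by
    have h := hasFDerivWithinAt_tangentCoordChange (I := 𝓡∂ 2)
      ⟨(extChartAt (𝓡∂ 2) c).map_target hz.1, hz.2⟩
    rw [(extChartAt (𝓡∂ 2) c).right_inv hz.1] at h
    exact h.mono (inter_subset_left.trans (extChartAt_target_subset c))
  rw [hres c d hfd, hres d c hfc, ← himage,
    integral_image_eq_integral_abs_det_fderiv_smul volume
      (measurableSet_coordChange_source c d) hder hinj]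
  refine setIntegral_congr_fun (measurableSet_coordChange_source c d) fun z hz => ?_
  have h := areaDensity_change hX ((extChartAt (𝓡∂ 2) c).map_target hz.1) hz.2
  rw [(extChartAt (𝓡∂ 2) c).right_inv hz.1] at h
  simp only [hτ, Function.comp_apply, (extChartAt (𝓡∂ 2) d).left_inv hz.2, smul_eq_mul]
  rw [h]
  ring

end ChartIntegral

/-! ### The divergence theorem for fields supported in a chart -/

section Calculus

variable {M : Type*} [TopologicalSpace M] [ChartedSpace (EuclideanHalfSpace 2) M]
variable {X : M → E3}

lemma surfGrad_eq_zero_of_notMem_tsupport {f : M → ℝ} {p : M} (hp : p ∉ tsupport f) :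
    surfGrad X f p = 0 := by
  have h : f =ᶠ[𝓝 p] fun _ => (0 : ℝ) := by
    filter_upwards [(isClosed_tsupport f).isOpen_compl.mem_nhds hp] with x hx
    exact image_eq_zero_of_notMem_tsupport hx
  have h2 : scalDiff f p = 0 := h.mfderiv_eq.trans mfderiv_const
  rw [surfGrad, h2, ContinuousLinearMap.zero_comp, map_zero]

lemma surfGrad_const (X : M → E3) (a : ℝ) (p : M) : surfGrad X (fun _ => a) p = 0 := by
  have h : scalDiff (fun _ : M => a) p = 0 := mfderiv_const
  rw [surfGrad, h, ContinuousLinearMap.zero_comp, map_zero]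

lemma isCompact_image_tsupport [CompactSpace M] {c : M} {f : M → ℝ}
    (hf : tsupport f ⊆ (extChartAt (𝓡∂ 2) c).source) :
    IsCompact (extChartAt (𝓡∂ 2) c '' tsupport f) :=
  (isClosed_tsupport _).isCompact.image_of_continuousOn ((continuousOn_extChartAt c).mono hf)

lemma image_tsupport_subset {c : M} {f : M → ℝ}
    (hf : tsupport f ⊆ (extChartAt (𝓡∂ 2) c).source) :
    extChartAt (𝓡∂ 2) c '' tsupport f ⊆ (extChartAt (𝓡∂ 2) c).target := by
  rintro _ ⟨p, hp, rfl⟩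
  exact (extChartAt (𝓡∂ 2) c).map_source (hf hp)

lemma notMem_tsupport_of_notMem {c : M} {f : M → ℝ} {z : E2}
    (hz : z ∈ (extChartAt (𝓡∂ 2) c).target) (hzK : z ∉ extChartAt (𝓡∂ 2) c '' tsupport f) :
    (extChartAt (𝓡∂ 2) c).symm z ∉ tsupport f := fun h =>
  hzK ⟨_, h, (extChartAt (𝓡∂ 2) c).right_inv hz⟩

variable [IsManifold (𝓡∂ 2) ∞ M]

lemma tangentProj_surfGrad (hX : IsSmoothImmersion X) {f : M → ℝ}
    (hf : MDifferentiable (𝓡∂ 2) 𝓘(ℝ, ℝ) f) (p : M) :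
    tangentProj X p (surfGrad X f p) = surfGrad X f p := by
  have hc := mem_extChartAt_source (I := 𝓡∂ 2) p
  have hA := hX.injective_coordDeriv hc
  refine ext_inner_right ℝ fun v => ?_
  rw [tangentProj_eq hX hc, ContinuousLinearMap.comp_apply, ← inner_apply_leftInv hA,
    real_inner_comm, inner_apply_leftInv hA, real_inner_comm, inner_surfGrad_eq hX hf hc,
    inner_surfGrad_eq hX hf hc, leftInv_apply_self hA]

lemma compDiv_smul (hX : IsSmoothImmersion X) {f : M → ℝ} {W : M → E3}
    (hf : ContMDiff (𝓡∂ 2) 𝓘(ℝ, ℝ) ∞ f) (hW : ContMDiff (𝓡∂ 2) 𝓘(ℝ, E3) ∞ W) (p : M) :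
    compDiv X (fun y => f y • W y) p = f p * compDiv X W p + ⟪surfGrad X f p, W p⟫_ℝ := by
  have hc := mem_extChartAt_source (I := 𝓡∂ 2) p
  have hz := mem_extChartAt_target (I := 𝓡∂ 2) p
  have hfd := hf.mdifferentiable (n := ∞) (by simp)
  have hWd := hW.mdifferentiable (n := ∞) (by simp)
  have hfW := (show ContMDiff (𝓡∂ 2) 𝓘(ℝ, E3) ∞ fun y => f y • W y from
    hf.smul hW).mdifferentiable (by simp)
  have hprod : coordDeriv (fun y => f y • W y) p (extChartAt (𝓡∂ 2) p p) =
      f p • coordDeriv W p (extChartAt (𝓡∂ 2) p p) +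
        (coordDeriv f p (extChartAt (𝓡∂ 2) p p)).smulRight (W p) := by
    have h := fderivWithin_fun_smul
      (uniqueDiffWithinAt_halfSpace (extChartAt_mem_range p p))
      (differentiableWithinAt_chart hfd p hz) (differentiableWithinAt_chart hWd p hz)
    simp only [Function.comp_apply, extChartAt_to_inv] at h
    exact h
  rw [compDiv, compDiv, compDeriv_eq hX hfW hc, compDeriv_eq hX hWd hc, inner_surfGrad_eq hX hfd hc,
    hprod, trace_comp_leftInv, trace_comp_leftInv]
  rw [E2_eq_sum (leftInv (coordDeriv X p (extChartAt (𝓡∂ 2) p p)) (W p))]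
  simp only [add_apply, smul_apply, ContinuousLinearMap.smulRight_apply, map_add, map_smul,
    PiLp.add_apply, PiLp.smul_apply, smul_eq_mul]
  ring

/-- In the chart centred at `c`, the density of the divergence of `f W` for a tangential field `W` is
the coordinate divergence of `f √g w`, where `w` are the components of `W`. -/
lemma exists_hasFDerivAt_chartField (hX : IsSmoothImmersion X) {f : M → ℝ}
    (hf : ContMDiff (𝓡∂ 2) 𝓘(ℝ, ℝ) ∞ f) {W : M → E3} (hW : ContMDiff (𝓡∂ 2) 𝓘(ℝ, E3) ∞ W)
    (htan : ∀ p, tangentProj X p (W p) = W p) {c : M} {z : E2}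
    (hz : z ∈ (extChartAt (𝓡∂ 2) c).target) (hz0 : 0 < z 0) :
    ∃ P' : E2 →L[ℝ] E2,
      HasFDerivAt (fun x => (f ((extChartAt (𝓡∂ 2) c).symm x) * areaDensity X c x) •
        leftInv (coordDeriv X c x) (W ((extChartAt (𝓡∂ 2) c).symm x))) P' z ∧
      P' (EuclideanSpace.single 0 1) 0 + P' (EuclideanSpace.single 1 1) 1 =
        compDiv X (fun y => f y • W y) ((extChartAt (𝓡∂ 2) c).symm z) * areaDensity X c z := by
  have hzU : z ∈ interior (extChartAt (𝓡∂ 2) c).target := (mem_interior_target hz).2 hz0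
  have hfd : ∀ {G : Type} [NormedAddCommGroup G] [NormedSpace ℝ G] (h : M → G),
      ∀ x ∈ interior (extChartAt (𝓡∂ 2) c).target,
        fderiv ℝ (fun z => h ((extChartAt (𝓡∂ 2) c).symm z)) x = coordDeriv h c x := fun h x hx =>
    (fderivWithin_of_mem_nhds (mem_of_superset (mem_interior_iff_mem_nhds.1 hx)
      (extChartAt_target_subset c))).symm
  have hYA := hfd X
  have htan' : ∀ x ∈ interior (extChartAt (𝓡∂ 2) c).target, coordDeriv X c x
      (leftInv (coordDeriv X c x) (W ((extChartAt (𝓡∂ 2) c).symm x))) =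
        W ((extChartAt (𝓡∂ 2) c).symm x) := fun x hx => by
    have h := htan ((extChartAt (𝓡∂ 2) c).symm x)
    rwa [tangentProj_eq hX ((extChartAt (𝓡∂ 2) c).map_target (interior_subset hx)),
      (extChartAt (𝓡∂ 2) c).right_inv (interior_subset hx), ContinuousLinearMap.comp_apply] at h
  obtain ⟨P', hP', hdivP⟩ := exists_hasFDerivAt_density_smul isOpen_interior
    ((contDiffOn_chart hX.1 c).mono interior_subset)
    (fun x hx => by
      rw [hYA x hx]; exact hX.injective_coordDeriv_target (interior_subset hx))
    ((contDiffOn_chart hW c).mono interior_subset) ((contDiffOn_chart hf c).mono interior_subset)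
    (fun x hx => by rw [hYA x hx]; exact htan' x hx) hzU
  refine ⟨P', hP'.congr_of_eventuallyEq ?_, ?_⟩
  · filter_upwards [isOpen_interior.mem_nhds hzU] with x hx
    rw [areaDensity_eq, hYA x hx]
  · rw [hdivP, hYA z hzU, hfd W z hzU, hfd f z hzU, areaDensity_eq, compDiv_smul hX hf hW,
      inner_surfGrad_eq hX (hf.mdifferentiable (by simp)) ((extChartAt (𝓡∂ 2) c).map_target hz),
      compDiv, compDeriv_eq hX (hW.mdifferentiable (by simp))
        ((extChartAt (𝓡∂ 2) c).map_target hz), (extChartAt (𝓡∂ 2) c).right_inv hz]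

lemma compDiv_smul_eq_zero (hX : IsSmoothImmersion X) {f : M → ℝ} {W : M → E3}
    (hf : ContMDiff (𝓡∂ 2) 𝓘(ℝ, ℝ) ∞ f) (hW : ContMDiff (𝓡∂ 2) 𝓘(ℝ, E3) ∞ W) {p : M}
    (hp : p ∉ tsupport f) : compDiv X (fun y => f y • W y) p = 0 := by
  rw [compDiv_smul hX hf hW, image_eq_zero_of_notMem_tsupport hp,
    surfGrad_eq_zero_of_notMem_tsupport hp, inner_zero_left, zero_mul, add_zero]

variable [CompactSpace M]

lemma integrableOn_chartIntegrand (hX : IsSmoothImmersion X) {c : M} {f h : M → ℝ}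
    (hf : tsupport f ⊆ (extChartAt (𝓡∂ 2) c).source)
    (hh : Continuous h) (h0 : ∀ p, p ∉ tsupport f → h p = 0) :
    IntegrableOn (fun z => h ((extChartAt (𝓡∂ 2) c).symm z) * areaDensity X c z)
      (extChartAt (𝓡∂ 2) c).target :=
  integrableOn_target (isCompact_image_tsupport hf) (image_tsupport_subset hf)
    ((hh.comp_continuousOn (continuousOn_extChartAt_symm c)).mul
      (contDiffOn_areaDensity hX c).continuousOn)
    fun z hz hzK => by rw [h0 _ (notMem_tsupport_of_notMem hz hzK), zero_mul]

/-- The divergence theorem for a tangential field supported in one chart. -/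
lemma chartIntegral_divergence (hX : IsSmoothImmersion X) {c : M} {f : M → ℝ}
    (hf : ContMDiff (𝓡∂ 2) 𝓘(ℝ, ℝ) ∞ f) (hfc : tsupport f ⊆ (extChartAt (𝓡∂ 2) c).source)
    {W : M → E3} (hW : ContMDiff (𝓡∂ 2) 𝓘(ℝ, E3) ∞ W)
    (htan : ∀ p, tangentProj X p (W p) = W p) :
    chartIntegral X c (compDiv X fun y => f y • W y) =
      ∫ s in {s : ℝ | (!₂[0, s] : E2) ∈ (extChartAt (𝓡∂ 2) c).target},
        f ((extChartAt (𝓡∂ 2) c).symm !₂[0, s]) *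
          ⟪W ((extChartAt (𝓡∂ 2) c).symm !₂[0, s]),
            conormal X ((extChartAt (𝓡∂ 2) c).symm !₂[0, s])⟫_ℝ * lineDensity X c !₂[0, s] := by
  -- the field in coordinates, extended by zero
  let P : E2 → E2 := (extChartAt (𝓡∂ 2) c).target.indicator fun z =>
    (f ((extChartAt (𝓡∂ 2) c).symm z) * areaDensity X c z) •
        leftInv (coordDeriv X c z) (W ((extChartAt (𝓡∂ 2) c).symm z))
  have hPin : ∀ z ∈ (extChartAt (𝓡∂ 2) c).target, P z =
      (f ((extChartAt (𝓡∂ 2) c).symm z) * areaDensity X c z) •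
        leftInv (coordDeriv X c z) (W ((extChartAt (𝓡∂ 2) c).symm z)) :=
    fun z hz => indicator_of_mem hz _
  have hPout : ∀ z ∉ (extChartAt (𝓡∂ 2) c).target, P z = 0 := fun z hz => indicator_of_notMem hz _
  clear_value P
  have hKc := isCompact_image_tsupport hfc
  have hPK : ∀ z, z ∉ extChartAt (𝓡∂ 2) c '' tsupport f → P z = 0 := fun z hzK => by
    by_cases hz : z ∈ (extChartAt (𝓡∂ 2) c).target
    · rw [hPin z hz, image_eq_zero_of_notMem_tsupport (notMem_tsupport_of_notMem hz hzK), zero_mul,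
        zero_smul]
    · exact hPout z hz
  have hP0 : ∀ z ∉ (extChartAt (𝓡∂ 2) c).target, P =ᶠ[𝓝 z] fun _ => 0 := fun z hz => by
    filter_upwards [hKc.isClosed.isOpen_compl.mem_nhds
      fun hk => hz (image_tsupport_subset hfc hk)] with x hx
    exact hPK x hx
  have hPcont : ContinuousOn P (range (𝓡∂ 2)) := by
    intro z _
    by_cases hz : z ∈ (extChartAt (𝓡∂ 2) c).target
    · have h1 := (((contDiffOn_chart hf c).mul (contDiffOn_areaDensity hX c)).smul
        (contDiffOn_leftInv (contDiffOn_coordDeriv hX.1 c) (contDiffOn_chart hW c)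
          fun _ hx => hX.injective_coordDeriv_target hx)).continuousOn z hz
      exact (h1.congr hPin (hPin z hz)).mono_of_mem_nhdsWithin
        (extChartAt_target_mem_nhdsWithin_of_mem hz)
    · exact (continuousAt_const.congr (hP0 z hz).symm).continuousWithinAt
  have hdiv : ∀ z : E2, 0 < z 0 → ∃ P' : E2 →L[ℝ] E2, HasFDerivAt P P' z ∧
      P' (EuclideanSpace.single 0 1) 0 + P' (EuclideanSpace.single 1 1) 1 =
        (extChartAt (𝓡∂ 2) c).target.indicator (fun z =>
          compDiv X (fun y => f y • W y) ((extChartAt (𝓡∂ 2) c).symm z) * areaDensity X c z) z := by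
    intro z hz0
    by_cases hz : z ∈ (extChartAt (𝓡∂ 2) c).target
    · obtain ⟨P', hP', hdivP⟩ := exists_hasFDerivAt_chartField hX hf hW htan hz hz0
      refine ⟨P', hP'.congr_of_eventuallyEq ?_, by rw [hdivP, indicator_of_mem hz]⟩
      filter_upwards [mem_interior_iff_mem_nhds.1 ((mem_interior_target hz).2 hz0)] with x hx
        using hPin x hx
    · exact ⟨0, (hasFDerivAt_const (0 : E2) z).congr_of_eventuallyEq (hP0 z hz),
        by rw [indicator_of_notMem hz]; simp⟩
  have hhint := ((integrable_indicator_iff (measurableSet_target c)).2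
      (integrableOn_chartIntegrand hX hfc (contMDiff_compDiv hX (hf.smul hW)).continuous
        fun p hp => compDiv_smul_eq_zero hX hf hW hp)).integrableOn (s := range (𝓡∂ 2))
  have hmain := integral_divergence_halfPlane hKc hPK hPcont hdiv hhint
  rw [setIntegral_indicator (measurableSet_target c),
    inter_eq_right.2 (extChartAt_target_subset c)] at hmain
  have hline : Measurable fun s : ℝ => (!₂[0, s] : E2) :=
    (planeEquiv.continuous.comp (Continuous.prodMk_right (0 : ℝ))).measurable
  have hmeas : MeasurableSet {s : ℝ | (!₂[0, s] : E2) ∈ (extChartAt (𝓡∂ 2) c).target} :=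
    hline (measurableSet_target c)
  rw [chartIntegral, hmain, ← integral_neg, ← integral_indicator hmeas]
  congr 1 with s
  by_cases hs : (!₂[0, s] : E2) ∈ (extChartAt (𝓡∂ 2) c).target
  · rw [indicator_of_mem
      (show s ∈ {s : ℝ | (!₂[0, s] : E2) ∈ (extChartAt (𝓡∂ 2) c).target} from hs), hPin _ hs]
    have hr := (extChartAt (𝓡∂ 2) c).right_inv hs
    have hn := inner_conormal_mul_lineDensity hX ((extChartAt (𝓡∂ 2) c).map_target hs)
      (by rw [hr]; rfl) (W ((extChartAt (𝓡∂ 2) c).symm !₂[0, s]))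
    rw [hr] at hn
    rw [mul_assoc, hn, PiLp.smul_apply, smul_eq_mul]
    ring
  · rw [indicator_of_notMem
      (show s ∉ {s : ℝ | (!₂[0, s] : E2) ∈ (extChartAt (𝓡∂ 2) c).target} from hs), hPout _ hs,
      PiLp.zero_apply, neg_zero]

end Calculus

/-! ### The partition of unity and the linearity of the surface integral -/

section Partition

variable {M : Type*} [TopologicalSpace M] [ChartedSpace (EuclideanHalfSpace 2) M]
  [IsManifold (𝓡∂ 2) ∞ M] [CompactSpace M] [T2Space M]
variable {X : M → E3}

lemma tsupport_chartPartition_subset (c : M) :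
    tsupport (chartPartition M c) ⊆ (extChartAt (𝓡∂ 2) c).source := by
  rw [extChartAt_source]
  exact (SmoothPartitionOfUnity.exists_isSubordinate_chartAt_source (𝓡∂ 2) M).choose_spec c

lemma contMDiff_chartPartition (c : M) :
    ContMDiff (𝓡∂ 2) 𝓘(ℝ, ℝ) ∞ (fun p => chartPartition M c p) :=
  (chartPartition M c).contMDiff

lemma mdifferentiable_chartPartition (c : M) :
    MDifferentiable (𝓡∂ 2) 𝓘(ℝ, ℝ) (fun p => chartPartition M c p) :=
  (contMDiff_chartPartition c).mdifferentiable (by simp)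

lemma finite_chartPartition : {c : M | (Function.support (chartPartition M c)).Nonempty}.Finite :=
  (chartPartition M).locallyFinite.finite_nonempty_of_compact

variable (M) in
/-- The finitely many indices whose partition function does not vanish identically. -/
noncomputable def partitionIndices : Finset M := (finite_chartPartition (M := M)).toFinset

lemma chartPartition_eq_zero {c : M} (hc : c ∉ partitionIndices M) (p : M) :
    chartPartition M c p = 0 := by
  by_contra h
  exact hc ((finite_chartPartition (M := M)).mem_toFinset.2 ⟨p, h⟩)

lemma sum_chartPartition (p : M) : ∑ c ∈ partitionIndices M, chartPartition M c p = 1 := by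
  rw [← (chartPartition M).sum_eq_one (mem_univ p)]
  refine (finsum_eq_sum_of_support_subset _ fun c hc => ?_).symm
  by_contra h
  exact hc (chartPartition_eq_zero h p)

lemma integrableOn_chartPartition_mul (hX : IsSmoothImmersion X) (c : M) {f : M → ℝ}
    (hf : Continuous f) :
    IntegrableOn (fun z => chartPartition M c ((extChartAt (𝓡∂ 2) c).symm z) *
      f ((extChartAt (𝓡∂ 2) c).symm z) * areaDensity X c z) (extChartAt (𝓡∂ 2) c).target :=
  integrableOn_chartIntegrand (h := fun p => chartPartition M c p * f p) hX
    (tsupport_chartPartition_subset c)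
    ((contMDiff_chartPartition c).continuous.mul hf)
    fun p hp => by rw [image_eq_zero_of_notMem_tsupport hp, zero_mul]

lemma surfaceIntegral_eq_sum (X : M → E3) (f : M → ℝ) : surfaceIntegral X f =
    ∑ c ∈ partitionIndices M, chartIntegral X c fun p => chartPartition M c p * f p := by
  refine finsum_eq_sum_of_support_subset _ fun c hc => ?_
  by_contra h
  refine hc ?_
  simp [chartPartition_eq_zero h]

lemma surfaceIntegral_add (hX : IsSmoothImmersion X) {f g : M → ℝ} (hf : Continuous f)
    (hg : Continuous g) :
    surfaceIntegral X (fun p => f p + g p) = surfaceIntegral X f + surfaceIntegral X g := by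
  simp only [surfaceIntegral_eq_sum, chartIntegral]
  rw [← Finset.sum_add_distrib]
  refine Finset.sum_congr rfl fun c _ => ?_
  rw [← integral_add (integrableOn_chartPartition_mul hX c hf)
    (integrableOn_chartPartition_mul hX c hg)]
  congr 1 with z
  ring

lemma surfaceIntegral_const_mul (X : M → E3) (a : ℝ) (f : M → ℝ) :
    surfaceIntegral X (fun p => a * f p) = a * surfaceIntegral X f := by
  simp only [surfaceIntegral_eq_sum, chartIntegral]
  rw [Finset.mul_sum]
  refine Finset.sum_congr rfl fun c _ => ?_
  rw [← integral_const_mul]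
  congr 1 with z
  ring

lemma surfaceIntegral_nonneg (X : M → E3) {f : M → ℝ} (hf : ∀ p, 0 ≤ f p) :
    0 ≤ surfaceIntegral X f := by
  rw [surfaceIntegral_eq_sum]
  refine Finset.sum_nonneg fun c _ => integral_nonneg fun z => ?_
  exact mul_nonneg (mul_nonneg ((chartPartition M).nonneg c _) (hf _)) (Real.sqrt_nonneg _)

/-- Integrals over the chart domains add up to a surface integral: the latter does not depend on
the partition of unity. -/
lemma sum_chartIntegral_eq (hX : IsSmoothImmersion X) {h : M → M → ℝ}
    (hh : ∀ c, Continuous (h c)) (h0 : ∀ c p, p ∉ tsupport (chartPartition M c) → h c p = 0) :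
    ∑ c ∈ partitionIndices M, chartIntegral X c (h c) =
      surfaceIntegral X fun p => ∑ c ∈ partitionIndices M, h c p := by
  -- insert `∑ ρ_d = 1` and integrate each `ρ_d h_c` in the chart at `d` instead of `c`
  have h1 : ∀ c, chartIntegral X c (h c) =
      ∑ d ∈ partitionIndices M, chartIntegral X c fun p => chartPartition M d p * h c p := fun c => by
    simp only [chartIntegral]
    rw [← integral_finsetSum]
    · congr 1 with z
      rw [← Finset.sum_mul, ← Finset.sum_mul, sum_chartPartition, one_mul]
    · intro d _
      exact integrableOn_chartIntegrand (h := fun p => chartPartition M d p * h c p) hX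
        (tsupport_chartPartition_subset c)
        ((contMDiff_chartPartition d).continuous.mul (hh c)) fun p hp => by rw [h0 c p hp, mul_zero]
  have h2 : ∀ c d, (chartIntegral X c fun p => chartPartition M d p * h c p) =
      chartIntegral X d fun p => chartPartition M d p * h c p := fun c d => by
    refine chartIntegral_change hX.mdifferentiable (fun p hp => ?_) fun p hp => ?_
    · refine tsupport_chartPartition_subset c (by_contra fun hn => hp ?_)
      rw [h0 c p hn, mul_zero]
    · refine tsupport_chartPartition_subset d (by_contra fun hn => hp ?_)
      rw [image_eq_zero_of_notMem_tsupport hn, zero_mul]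
  rw [Finset.sum_congr rfl fun c _ => (h1 c).trans (Finset.sum_congr rfl fun d _ => h2 c d),
    Finset.sum_comm, surfaceIntegral_eq_sum]
  refine Finset.sum_congr rfl fun d _ => ?_
  simp only [chartIntegral]
  rw [← integral_finsetSum]
  · congr 1 with z
    rw [← Finset.sum_mul, Finset.mul_sum]
  · exact fun c _ => integrableOn_chartPartition_mul hX d (hh c)

/-! ### The divergence theorem on the surface -/

lemma sum_surfGrad_chartPartition (hX : IsSmoothImmersion X) (p : M) :
    ∑ c ∈ partitionIndices M, surfGrad X (fun x => chartPartition M c x) p = 0 := by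
  refine ext_inner_right ℝ fun v => ?_
  have hz := mem_extChartAt_target (I := 𝓡∂ 2) p
  have hsum : ∑ c ∈ partitionIndices M,
      coordDeriv (fun x => chartPartition M c x) p (extChartAt (𝓡∂ 2) p p) = 0 := by
    have h1 := fderivWithin_fun_sum (𝕜 := ℝ) (s := range (𝓡∂ 2)) (u := partitionIndices M)
      (A := fun c z => chartPartition M c ((extChartAt (𝓡∂ 2) p).symm z))
      (uniqueDiffWithinAt_halfSpace (extChartAt_mem_range p p))
      fun c _ => differentiableWithinAt_chart (mdifferentiable_chartPartition c) p hz
    refine h1.symm.trans ?_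
    simp only [sum_chartPartition]
    simp
  rw [sum_inner, inner_zero_left]
  simp only [inner_surfGrad_eq hX (mdifferentiable_chartPartition _) (mem_extChartAt_source p)]
  rw [← sum_apply, hsum, zero_apply]

lemma boundaryIntegral_eq_sum (X : M → E3) (f : M → ℝ) : boundaryIntegral X f =
    ∑ c ∈ partitionIndices M,
      ∫ s in {s : ℝ | (!₂[0, s] : E2) ∈ (extChartAt (𝓡∂ 2) c).target},
        chartPartition M c ((extChartAt (𝓡∂ 2) c).symm !₂[0, s]) *
          f ((extChartAt (𝓡∂ 2) c).symm !₂[0, s]) * lineDensity X c !₂[0, s] := by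
  refine finsum_eq_sum_of_support_subset _ fun c hc => ?_
  by_contra h
  refine hc ?_
  simp [chartPartition_eq_zero h]

/-- The divergence theorem for tangential fields on a compact surface with boundary. -/
theorem surfaceIntegral_compDiv (hX : IsSmoothImmersion X) {W : M → E3}
    (hW : ContMDiff (𝓡∂ 2) 𝓘(ℝ, E3) ∞ W) (htan : ∀ p, tangentProj X p (W p) = W p) :
    surfaceIntegral X (compDiv X W) = boundaryIntegral X fun p => ⟪W p, conormal X p⟫_ℝ := by
  rw [boundaryIntegral_eq_sum, ← Finset.sum_congr rfl fun c _ => chartIntegral_divergence hX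
      (contMDiff_chartPartition c) (tsupport_chartPartition_subset c) hW htan,
    sum_chartIntegral_eq hX]
  · congr 1 with p
    simp only [compDiv_smul hX (contMDiff_chartPartition _) hW]
    rw [Finset.sum_add_distrib, ← Finset.sum_mul, sum_chartPartition, ← sum_inner,
      sum_surfGrad_chartPartition hX, inner_zero_left, one_mul, add_zero]
  · exact fun c => (contMDiff_compDiv hX ((contMDiff_chartPartition c).smul hW)).continuous
  · exact fun c p hp => compDiv_smul_eq_zero hX (contMDiff_chartPartition c) hW hp

/-- Integration by parts on a compact surface with boundary. -/
theorem surfaceIntegral_mul_compDiv (hX : IsSmoothImmersion X) {f : M → ℝ} {W : M → E3}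
    (hf : ContMDiff (𝓡∂ 2) 𝓘(ℝ, ℝ) ∞ f) (hW : ContMDiff (𝓡∂ 2) 𝓘(ℝ, E3) ∞ W)
    (htan : ∀ p, tangentProj X p (W p) = W p) :
    surfaceIntegral X (fun p => f p * compDiv X W p) +
        surfaceIntegral X (fun p => ⟪surfGrad X f p, W p⟫_ℝ) =
      boundaryIntegral X fun p => f p * ⟪W p, conormal X p⟫_ℝ := by
  rw [← surfaceIntegral_add (f := fun p => f p * compDiv X W p) hX
    (hf.continuous.mul (contMDiff_compDiv hX hW).continuous)
    ((contMDiff_surfGrad hX hf).continuous.inner hW.continuous)]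
  simp only [← compDiv_smul hX hf hW]
  have h := surfaceIntegral_compDiv hX (hf.smul hW) (fun p => by
    simp only [Pi.smul_apply', map_smul, htan])
  refine h.trans ?_
  congr 1 with p
  exact real_inner_smul_left _ _ _

end Partition

/-! ### The transport theorem -/

section Transport

variable {M : Type*} [TopologicalSpace M] [ChartedSpace (EuclideanHalfSpace 2) M]
variable {T : Set ℝ} {X : ℝ → M → E3} {ψ : ℝ → M → ℝ}

/-- Differentiation under the integral sign for integrands that are smooth in a chart and vanish off
a fixed compact set. -/
lemma hasDerivAt_integral_target {c : M} (hT : IsOpen T) {G : ℝ → E2 → ℝ} {K : Set E2}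
    (hK : IsCompact K) (hKt : K ⊆ (extChartAt (𝓡∂ 2) c).target)
    (hG : ContDiffOn ℝ ∞ (fun p : ℝ × E2 => G p.1 p.2) (T ×ˢ (extChartAt (𝓡∂ 2) c).target))
    (h0 : ∀ s, ∀ z ∈ (extChartAt (𝓡∂ 2) c).target, z ∉ K → G s z = 0) {g : E2 → ℝ} {t : ℝ}
    (ht : t ∈ T)
    (hg : ∀ z ∈ (extChartAt (𝓡∂ 2) c).target, 0 < z 0 → HasDerivAt (fun s => G s z) (g z) t) :
    HasDerivAt (fun s => ∫ z in (extChartAt (𝓡∂ 2) c).target, G s z)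
      (∫ z in (extChartAt (𝓡∂ 2) c).target, g z) t := by
  have hΩ := measurableSet_target c
  obtain ⟨ε, hε, hεT⟩ := Metric.nhds_basis_closedBall.mem_iff.1 (hT.mem_nhds ht)
  set G' : ℝ × E2 → ℝ := fun p => fderivWithin ℝ (fun p : ℝ × E2 => G p.1 p.2)
    (T ×ˢ (extChartAt (𝓡∂ 2) c).target) p (1, 0)
  have hG'c : ContinuousOn G' (T ×ˢ (extChartAt (𝓡∂ 2) c).target) :=
    ((hG.fderivWithin (m := ∞) (uniqueDiffOn_prod_target hT c) (by simp)).clm_apply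
      contDiffOn_const).continuousOn
  have hder : ∀ s ∈ T, ∀ z ∈ (extChartAt (𝓡∂ 2) c).target,
      HasDerivAt (fun s => G s z) (G' (s, z)) s := fun s hs z hz => by
    have h1 := (hG.differentiableOn (by simp) (s, z) ⟨hs, hz⟩).hasFDerivWithinAt
    have h2 : HasDerivWithinAt (fun s : ℝ => (s, z)) ((1, 0) : ℝ × E2) T s :=
      ((hasDerivAt_id s).prodMk (hasDerivAt_const s z)).hasDerivWithinAt
    have hmaps : MapsTo (fun s : ℝ => (s, z)) T (T ×ˢ (extChartAt (𝓡∂ 2) c).target) :=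
      fun s hs => ⟨hs, hz⟩
    exact (h1.comp_hasDerivWithinAt s h2 hmaps).hasDerivAt (hT.mem_nhds hs)
  have hG'0 : ∀ s ∈ T, ∀ z ∈ (extChartAt (𝓡∂ 2) c).target, z ∉ K → G' (s, z) = 0 :=
    fun s hs z hz hzK => by
      refine (hder s hs z hz).unique ?_
      simpa only [h0 _ z hz hzK] using hasDerivAt_const s (0 : ℝ)
  obtain ⟨C, hC⟩ := ((isCompact_closedBall t ε).prod hK).exists_bound_of_continuousOn
    (hG'c.mono (prod_mono hεT hKt))
  have hslice : ∀ s ∈ T, ContinuousOn (fun z => G s z) (extChartAt (𝓡∂ 2) c).target :=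
    fun s hs => hG.continuousOn.comp (continuous_const.prodMk continuous_id).continuousOn
      fun _ hz => ⟨hs, hz⟩
  have hslice' : ContinuousOn (fun z => G' (t, z)) (extChartAt (𝓡∂ 2) c).target :=
    hG'c.comp (continuous_const.prodMk continuous_id).continuousOn fun _ hz => ⟨ht, hz⟩
  have hmain := hasDerivAt_integral_of_dominated_loc_of_deriv_le
    (μ := volume.restrict (extChartAt (𝓡∂ 2) c).target) (F := G) (F' := fun s z => G' (s, z))
    (x₀ := t) (s := Metric.closedBall t ε) (bound := K.indicator fun _ => C)
    (Metric.closedBall_mem_nhds t hε)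
    (by
      filter_upwards [hT.mem_nhds ht] with s hs
      exact (hslice s hs).aestronglyMeasurable hΩ)
    (integrableOn_target hK hKt (hslice t ht) (h0 t))
    (hslice'.aestronglyMeasurable hΩ)
    ((ae_restrict_iff' hΩ).2 (Eventually.of_forall fun z hz s hs => by
      by_cases hzK : z ∈ K
      · rw [indicator_of_mem hzK]; exact hC (s, z) ⟨hs, hzK⟩
      · rw [indicator_of_notMem hzK, hG'0 s (hεT hs) z hz hzK, norm_zero]))
    (((integrable_indicator_iff hK.measurableSet).2
      (integrableOn_const hK.measure_lt_top.ne)).integrableOn)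
    ((ae_restrict_iff' hΩ).2 (Eventually.of_forall fun z hz s hs => hder s (hεT hs) z hz))
  refine hmain.2.congr_deriv (setIntegral_congr_ae hΩ ?_)
  filter_upwards [ae_coord_zero_ne] with z hz0 hz
  exact (hder t ht z hz).unique (hg z hz (lt_of_le_of_ne
    (mem_range_halfSpace.1 (extChartAt_target_subset c hz)) (Ne.symm hz0)))

variable [IsManifold (𝓡∂ 2) ∞ M]

lemma contMDiff_truesdellRate (hT : IsOpen T) (hX : IsSmoothFamily T X) (hψ : IsSmoothFamily T ψ)
    {t : ℝ} (ht : t ∈ T) (himm : IsSmoothImmersion (X t)) :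
    ContMDiff (𝓡∂ 2) 𝓘(ℝ, ℝ) ∞ (truesdellRate X ψ t) :=
  ((hψ.timeDeriv_family hT).contMDiff ht).add ((hψ.contMDiff ht).mul
    (contMDiff_compDiv himm ((hX.timeDeriv_family hT).contMDiff ht)))

/-- In a chart, the time derivative of `ψ √g` is the Truesdell rate times `√g`. -/
lemma hasDerivAt_mul_areaDensity (hT : IsOpen T) (hX : IsSmoothFamily T X)
    (hψ : IsSmoothFamily T ψ) {t : ℝ} (ht : t ∈ T) (himm : IsSmoothImmersion (X t)) {c : M} {z : E2}
    (hz : z ∈ (extChartAt (𝓡∂ 2) c).target) (hz0 : 0 < z 0) :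
    HasDerivAt (fun s => ψ s ((extChartAt (𝓡∂ 2) c).symm z) * areaDensity (X s) c z)
      (truesdellRate X ψ t ((extChartAt (𝓡∂ 2) c).symm z) * areaDensity (X t) c z) t := by
  have h1 : HasDerivAt (fun s => ψ s ((extChartAt (𝓡∂ 2) c).symm z))
      (timeDeriv ψ t ((extChartAt (𝓡∂ 2) c).symm z)) t :=
    (hψ.timeDeriv_eq hT ht hz).differentiableAt.hasDerivAt
  have h2 := hasDerivAt_sqrt_gramDet (hX.hasDerivAt_coordDeriv hT ht hz hz0)
    (himm.injective_coordDeriv_target hz)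
  simp only [areaDensity_eq]
  refine (h1.mul h2).congr_deriv ?_
  have hV : MDifferentiable (𝓡∂ 2) 𝓘(ℝ, E3) (timeDeriv X t) :=
    (hX.timeDeriv_family hT).mdifferentiable ht
  rw [truesdellRate, compDiv, compDeriv_eq himm hV ((extChartAt (𝓡∂ 2) c).map_target hz),
    (extChartAt (𝓡∂ 2) c).right_inv hz]
  ring

variable [CompactSpace M] [T2Space M]

/-- The transport theorem. -/
theorem hasDerivAt_surfaceIntegral (hT : IsOpen T) (hX : IsSmoothFamily T X)
    (hψ : IsSmoothFamily T ψ) (himm : ∀ t ∈ T, IsSmoothImmersion (X t)) {t : ℝ} (ht : t ∈ T) :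
    HasDerivAt (fun s => surfaceIntegral (X s) (ψ s))
      (surfaceIntegral (X t) (truesdellRate X ψ t)) t := by
  simp only [surfaceIntegral_eq_sum]
  refine HasDerivAt.fun_sum fun c _ => ?_
  refine hasDerivAt_integral_target hT
    (isCompact_image_tsupport (tsupport_chartPartition_subset c))
    (image_tsupport_subset (tsupport_chartPartition_subset c)) ?_ ?_ ht ?_
  · have hd : ContDiffOn ℝ ∞ (fun p : ℝ × E2 => areaDensity (X p.1) c p.2)
        (T ×ˢ (extChartAt (𝓡∂ 2) c).target) :=
      (contDiffOn_sqrt_gramDet (hX.contDiffOn_coordDeriv hT c) fun p hp =>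
        (himm p.1 hp.1).injective_coordDeriv_target hp.2).congr fun p _ => areaDensity_eq c p.2
    have hr : ContDiffOn ℝ ∞ (fun p : ℝ × E2 =>
        chartPartition M c ((extChartAt (𝓡∂ 2) c).symm p.2))
        (T ×ˢ (extChartAt (𝓡∂ 2) c).target) :=
      (isSmoothFamily_const (contMDiff_chartPartition c)).contDiffOn c
    exact (hr.mul (hψ.contDiffOn c)).mul hd
  · intro s z hz hzK
    simp only
    rw [image_eq_zero_of_notMem_tsupport (notMem_tsupport_of_notMem hz hzK), zero_mul, zero_mul]
  · intro z hz hz0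
    have h := (hasDerivAt_mul_areaDensity hT hX hψ ht (himm t ht) hz hz0).const_mul
      (chartPartition M c ((extChartAt (𝓡∂ 2) c).symm z))
    simpa only [mul_assoc] using h

end Transport

/-! ### First variations along the flow -/

section Variation

variable {F : Type*} [NormedAddCommGroup F] [NormedSpace ℝ F]

lemma timeDeriv_affine {N : Type*} (f g : N → F) (t : ℝ) : timeDeriv (fun ε y => f y + ε • g y) t = g := by
  ext y
  have h : HasDerivAt (fun ε : ℝ => f y + ε • g y) (g y) t := by
    simpa using ((hasDerivAt_id t).smul_const (g y)).const_add (f y)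
  exact h.deriv

lemma timeDeriv_const {N : Type*} (f : N → F) (t : ℝ) : timeDeriv (fun _ => f) t = 0 := by
  ext y
  simp [timeDeriv]

variable {M : Type*} [TopologicalSpace M] [ChartedSpace (EuclideanHalfSpace 2) M]
variable {T : Set ℝ} {X : ℝ → M → E3} {ψ : ℝ → M → ℝ} {U : (M → E3) → (M → ℝ) → ℝ}

lemma isSmoothFamily_affine {f g : M → F} (hf : ContMDiff (𝓡∂ 2) 𝓘(ℝ, F) ∞ f)
    (hg : ContMDiff (𝓡∂ 2) 𝓘(ℝ, F) ∞ g) (S : Set ℝ) :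
    IsSmoothFamily S fun ε y => f y + ε • g y :=
  ((hf.comp contMDiff_snd).add (contMDiff_fst.smul (hg.comp contMDiff_snd))).contMDiffOn

lemma IsSmoothFamily.comp_const_add {f : ℝ → M → F} (hf : IsSmoothFamily T f) (t : ℝ) {S : Set ℝ}
    (hS : ∀ ε ∈ S, t + ε ∈ T) : IsSmoothFamily S fun ε => f (t + ε) := by
  refine ContMDiffOn.comp (t := T ×ˢ univ) (g := fun p : ℝ × M => f p.1 p.2)
    (f := fun p : ℝ × M => (t + p.1, p.2)) hf ?_ (fun p hp => ⟨hS p.1 hp.1, mem_univ _⟩)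
  exact ((contMDiff_const.add contMDiff_fst).prodMk contMDiff_snd).contMDiffOn

/-- The chain rule along the motion. -/
lemma HasFirstVariation.hasDerivAt_motion (hT : IsOpen T) (hX : IsSmoothFamily T X)
    (hψ : IsSmoothFamily T ψ) {t : ℝ} (ht : t ∈ T) {L : (M → E3) × (M → ℝ) →ₗ[ℝ] ℝ}
    (hL : HasFirstVariation U (X t) (ψ t) L) :
    HasDerivAt (fun s => U (X s) (ψ s)) (L (timeDeriv X t, timeDeriv ψ t)) t := by
  obtain ⟨δ, hδ, hδT⟩ := Metric.isOpen_iff.1 hT t ht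
  have hmem : ∀ ε ∈ Ioo (-δ) δ, t + ε ∈ T := fun ε hε =>
    hδT (by simpa [abs_lt] using hε)
  have h := hL δ (fun ε => X (t + ε)) (fun ε => ψ (t + ε)) hδ (hX.comp_const_add t hmem)
    (hψ.comp_const_add t hmem) (by simp) (by simp)
  have hshift : ∀ {G : Type} [NormedAddCommGroup G] [NormedSpace ℝ G] (f : ℝ → M → G),
      timeDeriv (fun ε => f (t + ε)) 0 = timeDeriv f t := fun f => by
    ext y
    rw [timeDeriv, timeDeriv, deriv_comp_const_add (fun s => f s y), add_zero]
  rw [hshift X, hshift ψ] at h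
  rw [← sub_self t] at h
  simpa using h.comp_sub_const t t

variable [IsManifold (𝓡∂ 2) ∞ M] [CompactSpace M] [T2Space M]

lemma HasFirstVariation.apply_scalar {X : M → E3} {ψ g φ : M → ℝ}
    {L : (M → E3) × (M → ℝ) →ₗ[ℝ] ℝ} (hL : HasFirstVariation U X ψ L)
    (hg : IsScalarFunctionalDeriv U X ψ g) (hX : ContMDiff (𝓡∂ 2) 𝓘(ℝ, E3) ∞ X)
    (hψ : ContMDiff (𝓡∂ 2) 𝓘(ℝ, ℝ) ∞ ψ) (hφ : ContMDiff (𝓡∂ 2) 𝓘(ℝ, ℝ) ∞ φ) :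
    L (0, φ) = scalInner X g φ := by
  have h := hL 1 (fun _ => X) (fun ε y => ψ y + ε • φ y) one_pos (isSmoothFamily_const hX)
    (isSmoothFamily_affine hψ hφ _) rfl (by simp)
  rw [timeDeriv_affine, timeDeriv_const] at h
  exact h.unique (hg φ hφ)

lemma HasFirstVariation.apply_gauge {X G W : M → E3} {ψ : M → ℝ}
    {L : (M → E3) × (M → ℝ) →ₗ[ℝ] ℝ} (hL : HasFirstVariation U X ψ L)
    (hG : IsSpatialFunctionalDeriv truesdellGauge U X ψ G) (hX : IsSmoothImmersion X)
    (hψ : ContMDiff (𝓡∂ 2) 𝓘(ℝ, ℝ) ∞ ψ) (hW : ContMDiff (𝓡∂ 2) 𝓘(ℝ, E3) ∞ W) :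
    L (W, truesdellGauge X ψ W) = vecInner X G W := by
  have hgauge : ContMDiff (𝓡∂ 2) 𝓘(ℝ, ℝ) ∞ (truesdellGauge X ψ W) :=
    (hψ.mul (contMDiff_compDiv hX hW)).neg
  have hfam := isSmoothFamily_affine hψ hgauge (Ioo (-1) 1)
  have h := hL 1 (fun ε y => X y + ε • W y) (fun ε y => ψ y + ε • truesdellGauge X ψ W y) one_pos
    (isSmoothFamily_affine hX.1 hW _) hfam (by simp) (by simp)
  rw [timeDeriv_affine, timeDeriv_affine] at h
  exact h.unique (hG W hW 1 _ one_pos hfam (by simp) (timeDeriv_affine _ _ _))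

/-- The rate of change of the energy splits into a part for the motion of the surface under the
Truesdell gauge and a part for the gauge-invariant rate of the scalar field. -/
theorem hasDerivAt_energy (hT : IsOpen T) (hX : IsSmoothFamily T X) (hψ : IsSmoothFamily T ψ)
    {t : ℝ} (ht : t ∈ T) (himm : IsSmoothImmersion (X t))
    (hU : ∃ L, HasFirstVariation U (X t) (ψ t) L) {G : M → E3} {g : M → ℝ}
    (hG : IsSpatialFunctionalDeriv truesdellGauge U (X t) (ψ t) G)
    (hg : IsScalarFunctionalDeriv U (X t) (ψ t) g) :
    HasDerivAt (fun s => U (X s) (ψ s)) (vecInner (X t) G (timeDeriv X t) +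
      scalInner (X t) g (truesdellRate X ψ t)) t := by
  obtain ⟨L, hL⟩ := hU
  refine (hL.hasDerivAt_motion hT hX hψ ht).congr_deriv ?_
  rw [← hL.apply_gauge hG himm (hψ.contMDiff ht) ((hX.timeDeriv_family hT).contMDiff ht),
    ← hL.apply_scalar hg himm.1 (hψ.contMDiff ht) (contMDiff_truesdellRate hT hX hψ ht himm),
    ← map_add]
  congr 1
  refine Prod.ext (by simp) ?_
  ext y
  simp [truesdellRate, truesdellGauge]

end Variation

end SurfaceFlow

theorem proposition2
    {M : Type*} [TopologicalSpace M] [ChartedSpace (EuclideanHalfSpace 2) M]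
    [IsManifold (𝓡∂ 2) ∞ M] [CompactSpace M] [T2Space M]
    -- the energy and the immobility coefficients
    (U : (M → E3) → (M → ℝ) → ℝ) (MX Mψ : ℝ) (hMX : 0 < MX) (hMψ : 0 < Mψ)
    -- the evolving surface and the scalar field on it, in terms of material points
    (T : Set ℝ) (hT : IsOpen T) (X : ℝ → M → E3) (ψ : ℝ → M → ℝ)
    (hX : IsSmoothFamily T X) (hψ : IsSmoothFamily T ψ)
    (himm : ∀ t ∈ T, IsSmoothImmersion (X t))
    -- the functional derivatives of the energy
    (hU : ∀ t ∈ T, ∃ L, HasFirstVariation U (X t) (ψ t) L)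
    (DX : ℝ → M → E3) (Dψ : ℝ → M → ℝ)
    (hDX : ∀ t ∈ T, IsSpatialFunctionalDeriv truesdellGauge U (X t) (ψ t) (DX t))
    (hDψ : ∀ t ∈ T, IsScalarFunctionalDeriv U (X t) (ψ t) (Dψ t))
    (hDψ_smooth : ∀ t ∈ T, ContMDiff (𝓡∂ 2) 𝓘(ℝ, ℝ) ∞ (Dψ t))
    -- the gradient flow, in either of its two forms
    (q : ℝ → M → E3)
    (hV : ∀ t ∈ T, ∀ y, MX • timeDeriv X t y = -DX t y)
    (hq : ∀ t ∈ T, ∀ y, Mψ • q t y = -surfGrad (X t) (Dψ t) y)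
    (hflow : (∀ t ∈ T, ∀ y, Mψ * truesdellRate X ψ t y = laplaceBeltrami (X t) (Dψ t) y) ∨
      (∀ t ∈ T, ∀ y, truesdellRate X ψ t y = -covDiv (X t) (q t) y))
    -- the boundary conditions, void for closed surfaces
    (hbc : ∀ t ∈ T, boundaryIntegral (X t) (fun y => ⟪q t y, conormal (X t) y⟫_ℝ) = 0)
    (hbcU : ∀ t ∈ T,
      boundaryIntegral (X t) (fun y => Dψ t y * ⟪q t y, conormal (X t) y⟫_ℝ) = 0) :
    ∀ t ∈ T,
      HasDerivAt (fun s => surfaceIntegral (X s) (ψ s)) 0 t ∧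
      HasDerivAt (fun s => U (X s) (ψ s))
        (-(MX⁻¹ * vecNormSq (X t) (DX t) +
          Mψ⁻¹ * vecNormSq (X t) (surfGrad (X t) (Dψ t)))) t ∧
      -(MX⁻¹ * vecNormSq (X t) (DX t) + Mψ⁻¹ * vecNormSq (X t) (surfGrad (X t) (Dψ t))) =
        -(MX * vecNormSq (X t) (timeDeriv X t) + Mψ * vecNormSq (X t) (q t)) ∧
      -(MX * vecNormSq (X t) (timeDeriv X t) + Mψ * vecNormSq (X t) (q t)) ≤ 0 := by
  intro t ht
  have hXt := himm t ht
  have hMψ' := hMψ.ne'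
  have hMX' := hMX.ne'
  have hDs := hDψ_smooth t ht
  have hgs : ContMDiff (𝓡∂ 2) 𝓘(ℝ, E3) ∞ (surfGrad (X t) (Dψ t)) := contMDiff_surfGrad hXt hDs
  have hqeq : q t = fun y => (-Mψ⁻¹) • surfGrad (X t) (Dψ t) y := by
    ext1 y
    rw [← inv_smul_smul₀ hMψ' (q t y), hq t ht y, smul_neg, neg_smul]
  have hVeq : ∀ y, DX t y = -(MX • timeDeriv X t y) := fun y => by rw [hV t ht y, neg_neg]
  have hqs : ContMDiff (𝓡∂ 2) 𝓘(ℝ, E3) ∞ (q t) := by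
    rw [hqeq]
    exact (show ContMDiff (𝓡∂ 2) 𝓘(ℝ, ℝ) ∞ fun _ : M => -Mψ⁻¹ from contMDiff_const).smul hgs
  have hqtan : ∀ p, tangentProj (X t) p (q t p) = q t p := fun p => by
    rw [hqeq]
    simp only [map_smul, tangentProj_surfGrad hXt (hDs.mdifferentiable (by simp))]
  -- both forms of the flow equation say that the Truesdell rate is `-Div_C q`
  have hrate : ∀ y, truesdellRate X ψ t y = -1 * compDiv (X t) (q t) y := by
    intro y
    rcases hflow with h | h
    · have h1 := h t ht y
      rw [laplaceBeltrami, covDiv_eq_compDiv hXt (hgs.mdifferentiable (by simp))] at h1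
      have h2 : compDiv (X t) (q t) y = -Mψ⁻¹ * compDiv (X t) (surfGrad (X t) (Dψ t)) y := by
        rw [hqeq, compDiv_smul hXt contMDiff_const hgs, surfGrad_const, inner_zero_left, add_zero]
      rw [h2, ← h1]
      field_simp
    · rw [h t ht y, covDiv_eq_compDiv hXt (hqs.mdifferentiable (by simp)), neg_one_mul]
  have hmass : surfaceIntegral (X t) (truesdellRate X ψ t) = 0 := by
    simp only [funext hrate]
    rw [surfaceIntegral_const_mul, surfaceIntegral_compDiv hXt hqs hqtan, hbc t ht, mul_zero]
  -- by parts, the scalar part of the energy rate is a multiple of the squared norm of the flux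
  have hscal : scalInner (X t) (Dψ t) (truesdellRate X ψ t) =
      -(Mψ * vecNormSq (X t) (q t)) := by
    have hparts := surfaceIntegral_mul_compDiv hXt hDs hqs hqtan
    rw [hbcU t ht] at hparts
    have h1 : scalInner (X t) (Dψ t) (truesdellRate X ψ t) =
        -1 * surfaceIntegral (X t) fun p => Dψ t p * compDiv (X t) (q t) p := by
      rw [← surfaceIntegral_const_mul, scalInner]
      congr 1 with p
      rw [hrate]; ring
    have h2 : (surfaceIntegral (X t) fun p => ⟪surfGrad (X t) (Dψ t) p, q t p⟫_ℝ) =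
        -Mψ * vecNormSq (X t) (q t) := by
      rw [vecNormSq, ← surfaceIntegral_const_mul]
      congr 1 with p
      have h3 : surfGrad (X t) (Dψ t) p = -(Mψ • q t p) := by rw [hq t ht p, neg_neg]
      rw [h3, inner_neg_left, real_inner_smul_left, real_inner_self_eq_norm_sq, neg_mul]
    rw [h1]
    linear_combination (-1 : ℝ) * hparts + h2
  have hvec : vecInner (X t) (DX t) (timeDeriv X t) =
      -(MX * vecNormSq (X t) (timeDeriv X t)) := by
    rw [← neg_mul, vecNormSq, ← surfaceIntegral_const_mul, vecInner]
    congr 1 with p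
    rw [hVeq, inner_neg_left, real_inner_smul_left, real_inner_self_eq_norm_sq, neg_mul]
  have hDXn : vecNormSq (X t) (DX t) = MX ^ 2 * vecNormSq (X t) (timeDeriv X t) := by
    rw [vecNormSq, vecNormSq, ← surfaceIntegral_const_mul]
    congr 1 with p
    rw [hVeq, norm_neg, norm_smul, mul_pow, Real.norm_eq_abs, sq_abs]
  have hgn : vecNormSq (X t) (surfGrad (X t) (Dψ t)) = Mψ ^ 2 * vecNormSq (X t) (q t) := by
    rw [vecNormSq, vecNormSq, ← surfaceIntegral_const_mul]
    congr 1 with p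
    rw [← norm_neg, ← hq t ht p, norm_smul, mul_pow, Real.norm_eq_abs, sq_abs]
  have heq : -(MX⁻¹ * vecNormSq (X t) (DX t) +
        Mψ⁻¹ * vecNormSq (X t) (surfGrad (X t) (Dψ t))) =
      -(MX * vecNormSq (X t) (timeDeriv X t) + Mψ * vecNormSq (X t) (q t)) := by
    rw [hDXn, hgn]
    field_simp
  refine ⟨?_, ?_, heq, ?_⟩
  · rw [← hmass]
    exact hasDerivAt_surfaceIntegral hT hX hψ himm ht
  · rw [heq]
    refine (hasDerivAt_energy hT hX hψ ht hXt (hU t ht) (hDX t ht) (hDψ t ht)).congr_deriv ?_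
    rw [hvec, hscal]
    ring
  · have h1 : 0 ≤ vecNormSq (X t) (timeDeriv X t) :=
      surfaceIntegral_nonneg _ fun _ => sq_nonneg _
    have h2 : 0 ≤ vecNormSq (X t) (q t) := surfaceIntegral_nonneg _ fun _ => sq_nonneg _
    exact neg_nonpos.2 (by positivity)
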